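/- Let $n\ge 0$, $N=2n+2$, and consider $\mathbb R^N$ with coordinates $q_1,\dots,q_N$. Let $w_2$ be the constant tensor with $\{q_i,q_j\}=1$ for $i<j$, and let $w_3$ be the skew-symmetric tensor given, for $i<j$, by $$\{q_i,q_j\}=e^{q_{i-1}-q_i}+(1-\delta_{i+1,j})e^{q_i-q_{i+1}}+e^{q_{j-1}-q_j}+e^{q_j-q_{j+1}},$$ where a term containing $q_0$ or $q_{N+1}$ is omitted. Put $\mathcal R=w_3w_2^{-1}$ ($w_2$ is invertible), $w_j=\mathcal R^{j-2}w_2$ for $j\ge2$, $i_1=\sum_{i=1}^{N-1}e^{q_i-q_{i+1}}$, $\chi_1=w_2\,di_1$, $\chi_j=\mathcal R^{j-1}\chi_1$ for $j\ge 1$, and $$X_0=\sum_{i=1}^N (N-i+1)\frac{\partial}{\partial q_i},\qquad X_k=\mathcal R^kX_0\quad(k\ge0).$$ Here $(P\,df)_i=\sum_j P_{ij}\,\partial f/\partial x_j$ for a contravariant 2-tensor $P$, and $\mathcal L$ is the Lie derivative. Let $G(q)=(e^{q_1-q_2},\dots,e^{q_{N-1}-q_N})$, which maps $\mathbb R^N$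 onto $V_a=\{a\in\mathbb R^{N-1}: a_i>0\}$. For $a \in V_a$ let $L$ be the $N\times N$ tridiagonal matrix with zero diagonal, ones on the superdiagonal and $a_1,\dots,a_{N-1}$ on the subdiagonal, and let $I_l=\frac1{2l}\operatorname{Tr}L^{2l}$, $l\ge1$. Then the following holds. (1) The $w_j$, $j\ge2$, are Poisson tensors, and $X_0$ is a conformal symmetry: $\mathcal L_{X_0}w_2=0$, $\mathcal L_{X_0}w_3=w_3$, $X_0(i_1)=i_1$. (2) The smooth vector fields $X_k$, $k\ge0$, are master symmetries of all the flows $\chi_j$, $j\ge 1$, i.e. $[[X_k,\chi_j],\chi_j]=0$ and $[X_k,\chi_j]\ne0$ (as a vector field). There are smooth functions $i_j$, $j\ge 1$, beginning with the given $i_1$, such that $w_2\,di_j=\chi_j$ (this determines each $i_j$ up to an additive constant) and $i_j=I_j\circ G$; they satisfy $w_j\,di_l=w_{j-1}\,di_{l+1}$ for $j\ge3$, $l\ge 1$. One has the deformation relations $$X_k(i_j)=(k+j)\,i_{k+j}\ (k\ge0,\ j\ge1),\qquad \mathcal L_{X_k}w_j=(j-k-2)\,w_{k+j}\ (k\ge0,\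 j\ge2),\qquad [X_k,X_j]=(j-k)X_{k+j}\ (k,j\ge0).$$ (3) Under $G$ each $w_j$ ($j\ge2$) projects to a tensor $v_j$ and each $X_k$ ($k\ge0$) to a smooth vector field $Y_k$ on $V_a$, and these form the multi-Hamiltonian KM hierarchy, that is: * the $v_j$ are Poisson tensors; $v_2$ is given by $\{a_i,a_{i+1}\}=a_ia_{i+1}$ and $v_3$ by $\{a_i,a_{i+1}\}=a_ia_{i+1}(a_i+a_{i+1})$, $\{a_i,a_{i+2}\}=a_ia_{i+1}a_{i+2}$ (all other brackets with $i<j$ vanish); * $v_j$ is the restriction, by the involution $(a,b)\mapsto(a,-b)$, of the Toda tensor $\pi_{2j-2}$ to its fixed point set $b=0$: for functions $f,g$ that are smooth on $\{a_i>0\}\subset\mathbb R^{N-1}\times\mathbb R^N$ and invariant under the involution, $\{f,g\}_{\pi_{2j-2}}$ restricted to $b=0$ equals $\{f|_{b=0},g|_{b=0}\}_{v_j}$. Here $\pi_m$ ($m\ge1$) is the image under the Flaschka map $a_i=e^{q_i-q_{i+1}}$, $b_i=-p_i$ of $J_m=(J_2J_1^{-1})^{m-1}J_1$, where $$J_1=\begin{pmatrix}0&\mathrm{Id}\\-\mathrm{Id}&0\end{pmatrix},\qquad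 J_2=\begin{pmatrix}A&B\\-B&C\end{pmatrix}$$ on $\mathbb R^{2N}$ with coordinates $(q,p)$, $A$ and $C$ are skew-symmetric, $A_{ij}=1$ for $i<j$, $B=\operatorname{diag}(-p_1,\dots,-p_N)$, and the only nonzero entries of $C$ above the diagonal are $C_{i,i+1}=e^{q_i-q_{i+1}}$; * $v_2\,dI_1$ is the KM vector field $\dot a_i=a_i(a_{i+1}-a_{i-1})$ ($a_0=a_N=0$), $v_j\,dI_l=v_{j-1}\,dI_{l+1}$ for $j\ge3$, $l\ge1$, and $\{I_l,I_m\}_{v_j}=0$ for $j\ge2$, $l,m\ge1$; * $Y_k(I_j)=(k+j)I_{k+j}$ ($k\ge0$, $j\ge1$), $\mathcal L_{Y_k}v_j=(j-k-2)v_{k+j}$ ($k\ge0$, $j\ge2$), $[Y_k,Y_j]=(j-k)Y_{k+j}$ ($k,j\ge0$). -/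

import Mathlib

open scoped Matrix ContDiff

/-! Tensor calculus in the global coordinates of `ℝ^ι`.  A vector field is a function
`(ι → ℝ) → (ι → ℝ)`, a contravariant 2-tensor is a matrix-valued function with entries
`P x i j = {x_i, x_j}`. -/

namespace KM

noncomputable section

section Tensors

variable {ι κ : Type*} [Fintype ι] [DecidableEq ι]

/-- The partial derivative `∂f/∂x_l`. -/
def partialD (f : (ι → ℝ) → ℝ) (l : ι) (x : ι → ℝ) : ℝ :=
  fderiv ℝ f x (Pi.single l 1)

/-- The differential `df`, as the covector of partial derivatives. -/
def differential (f : (ι → ℝ) → ℝ) (x : ι → ℝ) : ι → ℝ :=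
  fun l => partialD f l x

/-- The vector field `P df`, with components `∑ j, P i j * ∂f/∂x_j = {x_i, f}`. -/
def hamField (P : (ι → ℝ) → Matrix ι ι ℝ) (f : (ι → ℝ) → ℝ) (x : ι → ℝ) : ι → ℝ :=
  P x *ᵥ differential f x

/-- The bracket `{f, g} = ∑ i j, ∂f/∂x_i * P i j * ∂g/∂x_j`. -/
def bracket (P : (ι → ℝ) → Matrix ι ι ℝ) (f g : (ι → ℝ) → ℝ) (x : ι → ℝ) : ℝ :=
  differential f x ⬝ᵥ hamField P g x

/-- The derivative `X(f) = L_X f` of a function along a vector field. -/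
def lieFun (X : (ι → ℝ) → ι → ℝ) (f : (ι → ℝ) → ℝ) (x : ι → ℝ) : ℝ :=
  fderiv ℝ f x (X x)

/-- The Lie derivative `L_X P` of a contravariant 2-tensor:
`(L_X P) i j = X(P i j) - ∑ k, (∂X_i/∂x_k) * P k j - ∑ k, P i k * (∂X_j/∂x_k)`. -/
def lieTensor (X : (ι → ℝ) → ι → ℝ) (P : (ι → ℝ) → Matrix ι ι ℝ) (x : ι → ℝ) :
    Matrix ι ι ℝ :=
  Matrix.of fun i j =>
    lieFun X (fun y => P y i j) x
      - ∑ k, partialD (fun y => X y i) k x * P x k j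
      - ∑ k, P x i k * partialD (fun y => X y j) k x

/-- `P` is a (smooth) Poisson tensor on the open set `U`. -/
structure IsPoissonOn (P : (ι → ℝ) → Matrix ι ι ℝ) (U : Set (ι → ℝ)) : Prop where
  smooth : ∀ i j, ContDiffOn ℝ ∞ (fun x => P x i j) U
  skew : ∀ x ∈ U, (P x)ᵀ = -P x
  jacobi : ∀ x ∈ U, ∀ i j k,
    ∑ l, (P x i l * partialD (fun y => P y j k) l x
      + P x j l * partialD (fun y => P y k i) l x
      + P x k l * partialD (fun y => P y i j) l x) = 0

/-- `Z` is a master symmetry of the vector field `χ`: `[[Z, χ], χ] = 0` but `[Z, χ] ≠ 0`. -/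
def IsMasterSymmetry (Z χ : (ι → ℝ) → ι → ℝ) : Prop :=
  VectorField.lieBracket ℝ (VectorField.lieBracket ℝ Z χ) χ = 0 ∧
    VectorField.lieBracket ℝ Z χ ≠ 0

/-- The Jacobian matrix of a map. -/
def jacobian (Φ : (ι → ℝ) → κ → ℝ) (x : ι → ℝ) : Matrix κ ι ℝ :=
  Matrix.of fun k i => partialD (fun y => Φ y k) i x

/-- The map `Φ` maps the tensor `P` to the tensor `Q`. -/
def MapsTensor (Φ : (ι → ℝ) → κ → ℝ) (P : (ι → ℝ) → Matrix ι ι ℝ)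
    (Q : (κ → ℝ) → Matrix κ κ ℝ) : Prop :=
  ∀ x, Q (Φ x) = jacobian Φ x * P x * (jacobian Φ x)ᵀ

/-- The map `Φ` maps the vector field `X` to the vector field `Y`. -/
def MapsField (Φ : (ι → ℝ) → κ → ℝ) (X : (ι → ℝ) → ι → ℝ) (Y : (κ → ℝ) → κ → ℝ) : Prop :=
  ∀ x, Y (Φ x) = jacobian Φ x *ᵥ X x

/-- The tensor `Q` on the fixed point set of the involution `φ` of the open set `U`, the fixed
point set being parametrized by `s : V → U`, is the reduction of the tensor `P` on `U`:
`{f, g}_P ∘ s = {f ∘ s, g ∘ s}_Q` for all `φ`-invariant smooth functions `f, g` on `U`. -/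
def IsInvolutionReduction [Fintype κ] [DecidableEq κ] (U : Set (ι → ℝ))
    (φ : (ι → ℝ) → ι → ℝ) (V : Set (κ → ℝ)) (s : (κ → ℝ) → ι → ℝ)
    (P : (ι → ℝ) → Matrix ι ι ℝ) (Q : (κ → ℝ) → Matrix κ κ ℝ) : Prop :=
  ∀ f g : (ι → ℝ) → ℝ, ContDiffOn ℝ ∞ f U → ContDiffOn ℝ ∞ g U →
    (∀ x ∈ U, f (φ x) = f x) → (∀ x ∈ U, g (φ x) = g x) →
    ∀ y ∈ V, bracket P f g (s y) = bracket Q (f ∘ s) (g ∘ s) y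

end Tensors

/-! The space `ℝ^N` of the coordinates `q_1, …, q_N`, where `N = 2n + 2`.  The coordinate `q_i`
is `q ⟨i - 1, _⟩`. -/

/-- `exp (q_{i-1} - q_i)`, omitted (zero) for the first index. -/
def leftTerm (n : ℕ) (q : Fin (2 * n + 2) → ℝ) (i : Fin (2 * n + 2)) : ℝ :=
  if 0 < (i : ℕ) then Real.exp (q ⟨i - 1, by omega⟩ - q i) else 0

/-- `exp (q_i - q_{i+1})`, omitted (zero) for the last index. -/
def rightTerm (n : ℕ) (q : Fin (2 * n + 2) → ℝ) (i : Fin (2 * n + 2)) : ℝ :=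
  if h : (i : ℕ) + 1 < 2 * n + 2 then Real.exp (q i - q ⟨i + 1, h⟩) else 0

/-- The constant tensor `w_2`: `{q_i, q_j} = 1` for `i < j`. -/
def w2 (n : ℕ) (_q : Fin (2 * n + 2) → ℝ) : Matrix (Fin (2 * n + 2)) (Fin (2 * n + 2)) ℝ :=
  Matrix.of fun i j => if i < j then 1 else if j < i then -1 else 0

/-- The value of `{q_i, q_j}` in the bracket `w_3`, for `i < j`. -/
def w3Entry (n : ℕ) (q : Fin (2 * n + 2) → ℝ) (i j : Fin (2 * n + 2)) : ℝ :=
  leftTerm n q i + (if (i : ℕ) + 1 = j then 0 else rightTerm n q i)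
    + leftTerm n q j + rightTerm n q j

/-- The tensor `w_3`. -/
def w3 (n : ℕ) (q : Fin (2 * n + 2) → ℝ) : Matrix (Fin (2 * n + 2)) (Fin (2 * n + 2)) ℝ :=
  Matrix.of fun i j =>
    if i < j then w3Entry n q i j else if j < i then -w3Entry n q j i else 0

/-- The recursion operator `R = w_3 w_2⁻¹`. -/
def recursion (n : ℕ) (q : Fin (2 * n + 2) → ℝ) :
    Matrix (Fin (2 * n + 2)) (Fin (2 * n + 2)) ℝ :=
  w3 n q * (w2 n q)⁻¹

/-- The higher tensors `w_j = R^{j-2} w_2`, for `j ≥ 2`. -/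
def w (n j : ℕ) (q : Fin (2 * n + 2) → ℝ) : Matrix (Fin (2 * n + 2)) (Fin (2 * n + 2)) ℝ :=
  recursion n q ^ (j - 2) * w2 n q

/-- The Hamiltonian `i_1 = ∑_{i=1}^{N-1} exp (q_i - q_{i+1})`. -/
def i1 (n : ℕ) (q : Fin (2 * n + 2) → ℝ) : ℝ :=
  ∑ i : Fin (2 * n + 1), Real.exp (q i.castSucc - q i.succ)

/-- The flows `χ_1 = w_2 di_1` and `χ_j = R^{j-1} χ_1`, for `j ≥ 1`. -/
def chi (n j : ℕ) (q : Fin (2 * n + 2) → ℝ) : Fin (2 * n + 2) → ℝ :=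
  recursion n q ^ (j - 1) *ᵥ hamField (w2 n) (i1 n) q

/-- `X_0 = ∑_{i=1}^N (N - i + 1) ∂/∂q_i`. -/
def X0 (n : ℕ) (_q : Fin (2 * n + 2) → ℝ) : Fin (2 * n + 2) → ℝ :=
  fun i => (2 * n + 2 : ℝ) - ((i : ℕ) + 1 : ℝ) + 1

/-- `X_k = R^k X_0`. -/
def X (n k : ℕ) (q : Fin (2 * n + 2) → ℝ) : Fin (2 * n + 2) → ℝ :=
  recursion n q ^ k *ᵥ X0 n q

/-! The phase space `a_1, …, a_{N-1} > 0` of the KM system. -/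

/-- The map `G(q) = (exp (q_1 - q_2), …, exp (q_{N-1} - q_N))`. -/
def G (n : ℕ) (q : Fin (2 * n + 2) → ℝ) : Fin (2 * n + 1) → ℝ :=
  fun i => Real.exp (q i.castSucc - q i.succ)

/-- The positive orthant. -/
def Va (n : ℕ) : Set (Fin (2 * n + 1) → ℝ) :=
  {a | ∀ i, 0 < a i}

/-- The KM vector field `a_i (a_{i+1} - a_{i-1})`, with `a_0 = a_N = 0`. -/
def kmField (n : ℕ) (a : Fin (2 * n + 1) → ℝ) : Fin (2 * n + 1) → ℝ :=
  fun i => a i *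
    ((if h : (i : ℕ) + 1 < 2 * n + 1 then a ⟨i + 1, h⟩ else 0)
      - (if 0 < (i : ℕ) then a ⟨i - 1, by omega⟩ else 0))

/-- The Lax matrix of the KM system. -/
def lax (n : ℕ) (a : Fin (2 * n + 1) → ℝ) : Matrix (Fin (2 * n + 2)) (Fin (2 * n + 2)) ℝ :=
  Matrix.of fun i j =>
    if (i : ℕ) + 1 = j then 1
    else if h : (j : ℕ) + 1 = i then a ⟨j, by omega⟩ else 0

/-- The KM integrals `I_l = (1 / 2l) Tr L^{2l}`. -/
def I (n l : ℕ) (a : Fin (2 * n + 1) → ℝ) : ℝ :=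
  (lax n a ^ (2 * l)).trace / (2 * l : ℝ)

/-- The value of `{a_i, a_j}` in the quadratic bracket `v_2`, for `i < j`. -/
def v2Entry (n : ℕ) (a : Fin (2 * n + 1) → ℝ) (i j : Fin (2 * n + 1)) : ℝ :=
  if (i : ℕ) + 1 = j then a i * a j else 0

/-- The quadratic KM bracket `{a_i, a_{i+1}} = a_i a_{i+1}`. -/
def v2 (n : ℕ) (a : Fin (2 * n + 1) → ℝ) : Matrix (Fin (2 * n + 1)) (Fin (2 * n + 1)) ℝ :=
  Matrix.of fun i j => v2Entry n a i j - v2Entry n a j i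

/-- The value of `{a_i, a_j}` in the cubic bracket `v_3`, for `i < j`. -/
def v3Entry (n : ℕ) (a : Fin (2 * n + 1) → ℝ) (i j : Fin (2 * n + 1)) : ℝ :=
  if (i : ℕ) + 1 = j then a i * a j * (a i + a j)
  else if h : (i : ℕ) + 2 = j then a i * a ⟨i + 1, by omega⟩ * a j else 0

/-- The cubic KM bracket `{a_i, a_{i+1}} = a_i a_{i+1} (a_i + a_{i+1})`,
`{a_i, a_{i+2}} = a_i a_{i+1} a_{i+2}`. -/
def v3 (n : ℕ) (a : Fin (2 * n + 1) → ℝ) : Matrix (Fin (2 * n + 1)) (Fin (2 * n + 1)) ℝ :=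
  Matrix.of fun i j => v3Entry n a i j - v3Entry n a j i

/-! The Toda lattice with `N = 2n + 2` particles.  The coordinates on the `(q, p)` space are
indexed by `Fin N ⊕ Fin N`, those on the `(a, b)` space by `Fin (N - 1) ⊕ Fin N`. -/

/-- The canonical Poisson tensor `J_1`. -/
def J1 (n : ℕ) (_x : Fin (2 * n + 2) ⊕ Fin (2 * n + 2) → ℝ) :
    Matrix (Fin (2 * n + 2) ⊕ Fin (2 * n + 2)) (Fin (2 * n + 2) ⊕ Fin (2 * n + 2)) ℝ :=
  Matrix.fromBlocks 0 1 (-1) 0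

/-- The tensor `J_2` of Das and Okubo, with blocks `A`, `B`, `-B`, `C`, where
`A i j = 1 = -A j i` for `i < j`, `B = diag (-p_1, …, -p_N)`, and `C` is skew-symmetric with
nonzero entries `C i (i+1) = -C (i+1) i = exp (q_i - q_{i+1})`. -/
def J2 (n : ℕ) (x : Fin (2 * n + 2) ⊕ Fin (2 * n + 2) → ℝ) :
    Matrix (Fin (2 * n + 2) ⊕ Fin (2 * n + 2)) (Fin (2 * n + 2) ⊕ Fin (2 * n + 2)) ℝ :=
  Matrix.fromBlocks
    (Matrix.of fun i j => if i < j then 1 else if j < i then -1 else 0)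
    (Matrix.diagonal fun i => -x (Sum.inr i))
    (-Matrix.diagonal fun i => -x (Sum.inr i))
    (Matrix.of fun i j =>
      if (i : ℕ) + 1 = j then Real.exp (x (Sum.inl i) - x (Sum.inl j))
      else if (j : ℕ) + 1 = i then -Real.exp (x (Sum.inl j) - x (Sum.inl i)) else 0)

/-- The Toda hierarchy `J_m = (J_2 J_1⁻¹)^{m-1} J_1`, for `m ≥ 1`. -/
def J (n m : ℕ) (x : Fin (2 * n + 2) ⊕ Fin (2 * n + 2) → ℝ) :
    Matrix (Fin (2 * n + 2) ⊕ Fin (2 * n + 2)) (Fin (2 * n + 2) ⊕ Fin (2 * n + 2)) ℝ :=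
  (J2 n x * (J1 n x)⁻¹) ^ (m - 1) * J1 n x

/-- The Flaschka transformation `a_i = exp (q_i - q_{i+1})`, `b_i = -p_i`. -/
def flaschka (n : ℕ) (x : Fin (2 * n + 2) ⊕ Fin (2 * n + 2) → ℝ) :
    Fin (2 * n + 1) ⊕ Fin (2 * n + 2) → ℝ :=
  Sum.elim (fun i => Real.exp (x (Sum.inl i.castSucc) - x (Sum.inl i.succ)))
    (fun i => -x (Sum.inr i))

/-- The phase space of the Toda lattice in the variables `(a, b)`. -/
def Tab (n : ℕ) : Set (Fin (2 * n + 1) ⊕ Fin (2 * n + 2) → ℝ) :=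
  {y | ∀ i, 0 < y (Sum.inl i)}

/-- The involution `φ(a, b) = (a, -b)`. -/
def todaInvolution (n : ℕ) (y : Fin (2 * n + 1) ⊕ Fin (2 * n + 2) → ℝ) :
    Fin (2 * n + 1) ⊕ Fin (2 * n + 2) → ℝ :=
  Sum.elim (fun i => y (Sum.inl i)) (fun i => -y (Sum.inr i))

/-- The parametrization `a ↦ (a, 0)` of the fixed point set of the involution. -/
def todaFixed (n : ℕ) (a : Fin (2 * n + 1) → ℝ) : Fin (2 * n + 1) ⊕ Fin (2 * n + 2) → ℝ :=
  Sum.elim a (fun _ => 0)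

end

end KM

/-!
Write `A` for the constant matrix of `w_2` and `C` for the tridiagonal skew matrix with entries
`a_k = exp (q_k - q_{k+1})` above the diagonal. Then `w_3 = -A C A` and `R = -A C` (`w3_eq`,
`recursion_eq`), and everything rests on two properties of `R`.

* The 2-form with matrix `C` is closed (`skewTri_closed`) and the Nijenhuis torsion of `R` vanishes
  (`skewTri_torsion`). Both become identities between neighbouring coordinates because taking
  differences along the edges makes the nonlocal matrix `A` local (`diff_mul_signMatrix`).
* For vector fields `X` these say `L_{RX} R = R L_X R` and
  `L_{RX} A = (L_X A) Rᵀ - (L_X R) A` (`IsBiHamiltonian.lieEnd_mulVec`,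
  `IsBiHamiltonian.lieTensor_mulVec`). Hence, if `L_X A = 0`, then
  `L_{R^m X} A = -(L_X R^m) A` for all `m`, which yields `L_{R^m X} (R^m A) = 0`.

For `X = A df` the last identity is the Jacobi identity of `w_{m+2} = R^m A`. For `X = X_0`, where
`L_{X_0} R = R`, the same formulas are the deformation relations of the `w_j` and the `X_k`.

The functions `i_l = I_l ∘ G` satisfy the Lenard recursion `d i_{l+1} = Rᵀ d i_l` (`lenard`). Let
`S` be the superdiagonal part of the Lax matrix and `P = L^(2l)`. The components of `d i_{l+1}` are
the diagonal entries of the commutator `[S, L^(2l+1)]`; since `L` commutes with `P` this commutator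
involves only the diagonal entries of `P`, which are in turn combinations of `a_k ∂I_l/∂a_k`. It
follows that `χ_l = A d i_l`, that these fields preserve `R` and commute, that the integrals are in
involution, and that `X_k(i_l) = ⟨d i_{k+l}, X_0⟩ = X_0(i_{k+l}) = (k + l) i_{k+l}`.

Since `R` depends on `q` only through `a = G(q)`, everything projects by `G`, and Lie derivatives
are natural (`MapsTensor.lieTensor`, `MapsField.lieBracket`). Finally, at `b = 0` the square of the
Toda recursion operator `J_2 J_1⁻¹` is block diagonal with first block `R` (`todaPi_todaFixed`), so
that the first block of `J_{2j-2}` is `w_j`; this gives the reduction of the Toda tensors.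
-/


open scoped Matrix ContDiff

set_option linter.unusedSectionVars false

namespace KM

noncomputable section

/-! ### Lie derivatives in coordinates -/

section Calculus

variable {ι κ μ ν : Type*} [Fintype ι] [DecidableEq ι]

/-- A matrix-valued map with smooth entries. -/
def SmoothMatrix (M : (ι → ℝ) → Matrix κ μ ℝ) : Prop :=
  ∀ i j, ContDiff ℝ ∞ fun x => M x i j

/-- The entrywise derivative of a matrix-valued map at `x` in the direction `v`. -/
def dirDeriv (M : (ι → ℝ) → Matrix κ μ ℝ) (x v : ι → ℝ) : Matrix κ μ ℝ :=
  Matrix.of fun i j => fderiv ℝ (fun y => M y i j) x v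

/-- The Lie derivative of a field of endomorphisms (a tensor of type `(1, 1)`). -/
def lieEnd (X : (ι → ℝ) → ι → ℝ) (M : (ι → ℝ) → Matrix ι ι ℝ) (x : ι → ℝ) : Matrix ι ι ℝ :=
  dirDeriv M x (X x) - jacobian X x * M x + M x * jacobian X x

/-- The matrix of the linear map `v ↦ (D_v M) u`, for a fixed vector `u`. -/
def derivApply (M : (ι → ℝ) → Matrix κ ι ℝ) (x u : ι → ℝ) : Matrix κ ι ℝ :=
  Matrix.of fun i k => ∑ l, partialD (fun y => M y i l) k x * u l

theorem fderiv_eq_sum_partialD (f : (ι → ℝ) → ℝ) (x v : ι → ℝ) :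
    fderiv ℝ f x v = ∑ l, partialD f l x * v l := by
  conv_lhs => rw [pi_eq_sum_univ' v]
  simp only [map_sum, map_smul, partialD, smul_eq_mul]
  refine Finset.sum_congr rfl fun l _ => ?_
  rw [mul_comm]

theorem fderiv_eq_dotProduct (f : (ι → ℝ) → ℝ) (x v : ι → ℝ) :
    fderiv ℝ f x v = differential f x ⬝ᵥ v :=
  fderiv_eq_sum_partialD f x v

theorem jacobian_mulVec (X : (ι → ℝ) → κ → ℝ) (x v : ι → ℝ) (i : κ) :
    (jacobian X x *ᵥ v) i = fderiv ℝ (fun y => X y i) x v := by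
  rw [fderiv_eq_sum_partialD]; rfl

theorem jacobian_mulVec_eq_fderiv [Fintype κ] {X : (ι → ℝ) → κ → ℝ} (hX : ContDiff ℝ ∞ X)
    (x v : ι → ℝ) : jacobian X x *ᵥ v = fderiv ℝ X x v := by
  ext i
  rw [jacobian_mulVec, fderiv_pi fun i => (contDiff_pi.1 hX i).differentiable (by simp) x]
  rfl

theorem matrix_ext_mulVec [Fintype μ] [DecidableEq μ] {M M' : Matrix κ μ ℝ}
    (h : ∀ v, M *ᵥ v = M' *ᵥ v) : M = M' :=
  Matrix.mulVec_injective (funext h)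

theorem derivApply_mulVec (M : (ι → ℝ) → Matrix κ ι ℝ) (x u v : ι → ℝ) :
    derivApply M x u *ᵥ v = dirDeriv M x v *ᵥ u := by
  ext i
  simp only [derivApply, dirDeriv, Matrix.mulVec, dotProduct, Matrix.of_apply,
    fderiv_eq_sum_partialD, Finset.sum_mul]
  rw [Finset.sum_comm]
  exact Finset.sum_congr rfl fun _ _ => Finset.sum_congr rfl fun _ _ => by ring

theorem SmoothMatrix.differentiableAt {M : (ι → ℝ) → Matrix κ μ ℝ} (hM : SmoothMatrix M)
    (i : κ) (j : μ) (x : ι → ℝ) : DifferentiableAt ℝ (fun y => M y i j) x :=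
  (hM i j).differentiable (by simp) x

theorem SmoothMatrix.mul [Fintype μ] {M : (ι → ℝ) → Matrix κ μ ℝ} {M' : (ι → ℝ) → Matrix μ ν ℝ}
    (hM : SmoothMatrix M) (hM' : SmoothMatrix M') : SmoothMatrix fun x => M x * M' x := by
  intro i j
  simp only [Matrix.mul_apply]
  exact ContDiff.sum fun k _ => (hM i k).mul (hM' k j)

theorem SmoothMatrix.transpose {M : (ι → ℝ) → Matrix κ μ ℝ}
    (hM : SmoothMatrix M) : SmoothMatrix fun x => (M x)ᵀ :=
  fun i j => hM j i

theorem smoothMatrix_const (M : Matrix κ μ ℝ) : SmoothMatrix fun _ : ι → ℝ => M :=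
  fun _ _ => contDiff_const

theorem SmoothMatrix.pow [Fintype κ] [DecidableEq κ] {M : (ι → ℝ) → Matrix κ κ ℝ}
    (hM : SmoothMatrix M) (m : ℕ) : SmoothMatrix fun x => M x ^ m := by
  induction m with
  | zero => simpa using smoothMatrix_const 1
  | succ m ih => simpa only [pow_succ] using ih.mul hM

theorem SmoothMatrix.mulVec [Fintype μ] [Fintype κ] {M : (ι → ℝ) → Matrix κ μ ℝ}
    {X : (ι → ℝ) → μ → ℝ} (hM : SmoothMatrix M) (hX : ContDiff ℝ ∞ X) :
    ContDiff ℝ ∞ fun x => M x *ᵥ X x := by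
  rw [contDiff_pi]
  intro i
  simp only [Matrix.mulVec, dotProduct]
  exact ContDiff.sum fun k _ => (hM i k).mul (contDiff_pi.1 hX k)

theorem SmoothMatrix.comp [Fintype ν] {M : (ν → ℝ) → Matrix κ μ ℝ} [DecidableEq ν]
    {Φ : (ι → ℝ) → ν → ℝ} (hM : SmoothMatrix M) (hΦ : ContDiff ℝ ∞ Φ) :
    SmoothMatrix fun x => M (Φ x) :=
  fun i j => (hM i j).comp hΦ

theorem contDiff_partialD {f : (ι → ℝ) → ℝ} (hf : ContDiff ℝ ∞ f) (l : ι) :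
    ContDiff ℝ ∞ (partialD f l) :=
  (hf.fderiv_right (m := ∞) (by simp)).clm_apply contDiff_const

theorem contDiff_differential {f : (ι → ℝ) → ℝ} (hf : ContDiff ℝ ∞ f) :
    ContDiff ℝ ∞ (differential f) :=
  contDiff_pi.2 fun l => contDiff_partialD hf l

theorem smoothMatrix_jacobian [Fintype κ] {Φ : (ι → ℝ) → κ → ℝ} (hΦ : ContDiff ℝ ∞ Φ) :
    SmoothMatrix (jacobian Φ) :=
  fun i j => contDiff_partialD (contDiff_pi.1 hΦ i) j

theorem partialD_comm {f : (ι → ℝ) → ℝ} (hf : ContDiff ℝ ∞ f) (k l : ι) (x : ι → ℝ) :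
    partialD (partialD f k) l x = partialD (partialD f l) k x := by
  have hd : DifferentiableAt ℝ (fderiv ℝ f) x :=
    (hf.fderiv_right (m := ∞) (by simp)).differentiable (by simp) x
  have key : ∀ k l : ι, partialD (partialD f k) l x
      = fderiv ℝ (fderiv ℝ f) x (Pi.single l 1) (Pi.single k 1) := by
    intro k l
    have : partialD f k = fun y => fderiv ℝ f y (Pi.single k 1) := rfl
    rw [partialD, this, fderiv_clm_apply hd (differentiableAt_const _)]
    simp
  rw [key, key]
  exact (hf.contDiffAt.isSymmSndFDerivAt (by
    rw [minSmoothness_of_isRCLikeNormedField]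
    exact WithTop.coe_le_coe.2 (le_top (a := (2 : ℕ∞))))) _ _

theorem jacobian_differential_transpose {f : (ι → ℝ) → ℝ} (hf : ContDiff ℝ ∞ f) (x : ι → ℝ) :
    (jacobian (differential f) x)ᵀ = jacobian (differential f) x := by
  ext i j
  exact partialD_comm hf j i x

/-- The symmetry of the second derivative of a map, in terms of its Jacobian matrix. -/
theorem derivApply_jacobian [Fintype κ] {Φ : (ι → ℝ) → κ → ℝ} (hΦ : ContDiff ℝ ∞ Φ)
    (x u : ι → ℝ) : derivApply (jacobian Φ) x u = dirDeriv (jacobian Φ) x u := by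
  ext k i
  simp only [derivApply, dirDeriv, Matrix.of_apply, fderiv_eq_sum_partialD]
  refine Finset.sum_congr rfl fun l _ => ?_
  congr 1
  exact partialD_comm (contDiff_pi.1 hΦ k) l i x

theorem dirDeriv_const (M : Matrix κ μ ℝ) (x v : ι → ℝ) :
    dirDeriv (fun _ => M) x v = 0 := by
  ext i j
  simp [dirDeriv]

theorem dirDeriv_transpose (M : (ι → ℝ) → Matrix κ μ ℝ) (x v : ι → ℝ) :
    dirDeriv (fun y => (M y)ᵀ) x v = (dirDeriv M x v)ᵀ := rfl

theorem dirDeriv_mul [Fintype μ] {M : (ι → ℝ) → Matrix κ μ ℝ} {M' : (ι → ℝ) → Matrix μ ν ℝ}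
    (hM : SmoothMatrix M) (hM' : SmoothMatrix M') (x v : ι → ℝ) :
    dirDeriv (fun y => M y * M' y) x v = dirDeriv M x v * M' x + M x * dirDeriv M' x v := by
  ext i j
  simp only [dirDeriv, Matrix.mul_apply, Matrix.of_apply, Matrix.add_apply]
  rw [fderiv_fun_sum fun k _ => (hM.differentiableAt i k x).fun_mul (hM'.differentiableAt k j x),
    _root_.sum_apply, ← Finset.sum_add_distrib]
  refine Finset.sum_congr rfl fun k _ => ?_
  rw [fderiv_fun_mul (hM.differentiableAt i k x) (hM'.differentiableAt k j x)]
  simp only [_root_.add_apply, _root_.smul_apply, smul_eq_mul]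
  ring

theorem jacobian_mulVec_field [Fintype κ] {M : (ι → ℝ) → Matrix κ ι ℝ} {X : (ι → ℝ) → ι → ℝ}
    (hM : SmoothMatrix M) (hX : ContDiff ℝ ∞ X) (x : ι → ℝ) :
    jacobian (fun y => M y *ᵥ X y) x = derivApply M x (X x) + M x * jacobian X x := by
  ext i k
  have hXd : ∀ l, DifferentiableAt ℝ (fun y => X y l) x := fun l =>
    (contDiff_pi.1 hX l).differentiable (by simp) x
  simp only [jacobian, derivApply, partialD, Matrix.mul_apply, Matrix.of_apply, Matrix.add_apply,
    Matrix.mulVec, dotProduct]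
  rw [fderiv_fun_sum fun l _ => (hM.differentiableAt i l x).fun_mul (hXd l),
    _root_.sum_apply, ← Finset.sum_add_distrib]
  refine Finset.sum_congr rfl fun l _ => ?_
  rw [fderiv_fun_mul (hM.differentiableAt i l x) (hXd l)]
  simp only [_root_.add_apply, _root_.smul_apply, smul_eq_mul]
  ring

theorem jacobian_const (v : κ → ℝ) (x : ι → ℝ) : jacobian (fun _ : ι → ℝ => v) x = 0 := by
  ext i j
  simp [jacobian, partialD]

theorem jacobian_const_mulVec [Fintype κ] [Fintype μ] (M : Matrix κ μ ℝ)
    {F : (ι → ℝ) → μ → ℝ} (hF : ContDiff ℝ ∞ F) (x : ι → ℝ) :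
    jacobian (fun y => M *ᵥ F y) x = M * jacobian F x := by
  ext i k
  have hFd : ∀ l, DifferentiableAt ℝ (fun y => F y l) x := fun l =>
    (contDiff_pi.1 hF l).differentiable (by simp) x
  simp only [jacobian, partialD, Matrix.mul_apply, Matrix.of_apply, Matrix.mulVec, dotProduct]
  rw [fderiv_fun_sum fun l _ => (hFd l).const_mul (M i l), _root_.sum_apply]
  refine Finset.sum_congr rfl fun l _ => ?_
  rw [fderiv_const_mul (hFd l)]
  rfl

theorem jacobian_comp [Fintype κ] [DecidableEq κ] [Fintype μ] {Y : (κ → ℝ) → μ → ℝ}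
    {Φ : (ι → ℝ) → κ → ℝ} (hY : ContDiff ℝ ∞ Y) (hΦ : ContDiff ℝ ∞ Φ) (x : ι → ℝ) :
    jacobian (fun y => Y (Φ y)) x = jacobian Y (Φ x) * jacobian Φ x := by
  refine matrix_ext_mulVec fun v => ?_
  rw [← Matrix.mulVec_mulVec, jacobian_mulVec_eq_fderiv (X := fun y => Y (Φ y)) (hY.comp hΦ),
    jacobian_mulVec_eq_fderiv hY, jacobian_mulVec_eq_fderiv hΦ]
  change fderiv ℝ (Y ∘ Φ) x v = _
  rw [fderiv_comp x (hY.differentiable (by simp) _) (hΦ.differentiable (by simp) _)]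
  rfl

theorem dirDeriv_comp [Fintype ν] [DecidableEq ν] {M : (ν → ℝ) → Matrix κ μ ℝ}
    {Φ : (ι → ℝ) → ν → ℝ} (hM : SmoothMatrix M) (hΦ : ContDiff ℝ ∞ Φ) (x v : ι → ℝ) :
    dirDeriv (fun y => M (Φ y)) x v = dirDeriv M (Φ x) (jacobian Φ x *ᵥ v) := by
  ext i j
  rw [jacobian_mulVec_eq_fderiv hΦ]
  change fderiv ℝ ((fun z => M z i j) ∘ Φ) x v = _
  rw [fderiv_comp x (hM.differentiableAt i j _) (hΦ.differentiable (by simp) _)]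
  rfl

/-- The chain rule for differentials of functions. -/
theorem differential_comp [Fintype ν] [DecidableEq ν] {f : (ν → ℝ) → ℝ}
    {Φ : (ι → ℝ) → ν → ℝ} (hf : ContDiff ℝ ∞ f) (hΦ : ContDiff ℝ ∞ Φ) (x : ι → ℝ) :
    differential (fun y => f (Φ y)) x = (jacobian Φ x)ᵀ *ᵥ differential f (Φ x) := by
  ext l
  change fderiv ℝ (f ∘ Φ) x (Pi.single l 1) = _
  rw [fderiv_comp x (hf.differentiable (by simp) _) (hΦ.differentiable (by simp) _)]
  change fderiv ℝ f (Φ x) (fderiv ℝ Φ x (Pi.single l 1)) = _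
  rw [← jacobian_mulVec_eq_fderiv hΦ, fderiv_eq_sum_partialD, Matrix.mulVec_single_one]
  simp [Matrix.mulVec, dotProduct, differential, mul_comm]

theorem lieTensor_eq (X : (ι → ℝ) → ι → ℝ) (P : (ι → ℝ) → Matrix ι ι ℝ) (x : ι → ℝ) :
    lieTensor X P x = dirDeriv P x (X x) - jacobian X x * P x - P x * (jacobian X x)ᵀ := by
  ext i j
  simp [lieTensor, dirDeriv, jacobian, lieFun, Matrix.mul_apply]

theorem lieBracket_eq {X Y : (ι → ℝ) → ι → ℝ} (hX : ContDiff ℝ ∞ X) (hY : ContDiff ℝ ∞ Y)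
    (x : ι → ℝ) :
    VectorField.lieBracket ℝ X Y x = jacobian Y x *ᵥ X x - jacobian X x *ᵥ Y x := by
  rw [jacobian_mulVec_eq_fderiv hX, jacobian_mulVec_eq_fderiv hY]
  rfl

/-- The Lie derivative of fields of endomorphisms is a derivation. -/
theorem lieEnd_mul (X : (ι → ℝ) → ι → ℝ) {M M' : (ι → ℝ) → Matrix ι ι ℝ}
    (hM : SmoothMatrix M) (hM' : SmoothMatrix M') (x : ι → ℝ) :
    lieEnd X (fun y => M y * M' y) x = lieEnd X M x * M' x + M x * lieEnd X M' x := by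
  simp only [lieEnd, dirDeriv_mul hM hM']
  noncomm_ring

theorem lieEnd_pow_succ (X : (ι → ℝ) → ι → ℝ) {M : (ι → ℝ) → Matrix ι ι ℝ}
    (hM : SmoothMatrix M) (m : ℕ) (x : ι → ℝ) :
    lieEnd X (fun y => M y ^ (m + 1)) x
      = lieEnd X (fun y => M y ^ m) x * M x + M x ^ m * lieEnd X M x := by
  simp only [pow_succ]
  exact lieEnd_mul X (hM.pow m) hM x

theorem lieEnd_pow_zero (X : (ι → ℝ) → ι → ℝ) (M : (ι → ℝ) → Matrix ι ι ℝ) (x : ι → ℝ) :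
    lieEnd X (fun y => M y ^ 0) x = 0 := by
  simp [lieEnd, dirDeriv_const]

theorem lieTensor_mul (X : (ι → ℝ) → ι → ℝ) {M P : (ι → ℝ) → Matrix ι ι ℝ}
    (hM : SmoothMatrix M) (hP : SmoothMatrix P) (x : ι → ℝ) :
    lieTensor X (fun y => M y * P y) x = lieEnd X M x * P x + M x * lieTensor X P x := by
  simp only [lieEnd, lieTensor_eq, dirDeriv_mul hM hP]
  noncomm_ring

theorem lieBracket_mulVec {X Y : (ι → ℝ) → ι → ℝ} {M : (ι → ℝ) → Matrix ι ι ℝ}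
    (hX : ContDiff ℝ ∞ X) (hY : ContDiff ℝ ∞ Y) (hM : SmoothMatrix M) (x : ι → ℝ) :
    VectorField.lieBracket ℝ X (fun y => M y *ᵥ Y y) x
      = lieEnd X M x *ᵥ Y x + M x *ᵥ VectorField.lieBracket ℝ X Y x := by
  rw [lieBracket_eq hX hY, lieBracket_eq hX (hM.mulVec hY), jacobian_mulVec_field hM hY]
  simp only [lieEnd, Matrix.add_mulVec, Matrix.sub_mulVec, Matrix.mulVec_sub, derivApply_mulVec,
    Matrix.mulVec_mulVec]
  abel

end Calculus

/-! ### Bi-Hamiltonian pairs with a constant tensor -/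

section BiHamiltonian

variable {ι : Type*} [Fintype ι] [DecidableEq ι]

/-- A constant nondegenerate skew-symmetric tensor `A` together with a field `R` of endomorphisms
such that `R A` is skew-symmetric, `R` has vanishing Nijenhuis torsion (`torsion`, on constant
vector fields) and the 2-form `A⁻¹ R` is closed (`closed`).  Thus `A` and `R A` are compatible
Poisson tensors with recursion operator `R`. -/
structure IsBiHamiltonian (A : Matrix ι ι ℝ) (R : (ι → ℝ) → Matrix ι ι ℝ) : Prop where
  isUnit_det : IsUnit A.det
  smooth : SmoothMatrix R
  skew : Aᵀ = -A
  comm : ∀ x, R x * A = A * (R x)ᵀ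
  torsion : ∀ x u v, dirDeriv R x (R x *ᵥ u) *ᵥ v - dirDeriv R x (R x *ᵥ v) *ᵥ u
    = R x *ᵥ (dirDeriv R x u *ᵥ v - dirDeriv R x v *ᵥ u)
  closed : ∀ x u, derivApply R x u * A + A * (derivApply R x u)ᵀ = dirDeriv R x u * A

theorem pow_mul_eq_mul_transpose_pow {A R : Matrix ι ι ℝ} (h : R * A = A * Rᵀ) (m : ℕ) :
    R ^ m * A = A * Rᵀ ^ m := by
  induction m with
  | zero => simp
  | succ m ih => rw [pow_succ, mul_assoc, h, ← mul_assoc, ih, mul_assoc, ← pow_succ]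

theorem transpose_pow_mul {A R : Matrix ι ι ℝ} (hA : Aᵀ = -A) (h : R * A = A * Rᵀ) (m : ℕ) :
    (R ^ m * A)ᵀ = -(R ^ m * A) := by
  rw [Matrix.transpose_mul, hA, Matrix.transpose_pow, pow_mul_eq_mul_transpose_pow h, neg_mul]

/-- A constant vector field `Z` with `L_Z R = R`; as it preserves every constant tensor `A`, it is a
conformal symmetry of the pair `A`, `R A`. -/
def IsConformal (R : (ι → ℝ) → Matrix ι ι ℝ) (Z : ι → ℝ) : Prop :=
  ∀ x, dirDeriv R x Z = R x

/-- Hamiltonian vector fields of a constant tensor preserve it. -/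
theorem lieTensor_const_mulVec {A : Matrix ι ι ℝ} (hA : Aᵀ = -A) {ξ : (ι → ℝ) → ι → ℝ}
    (hξ : ContDiff ℝ ∞ ξ) (hs : ∀ x, (jacobian ξ x)ᵀ = jacobian ξ x) (x : ι → ℝ) :
    lieTensor (fun y => A *ᵥ ξ y) (fun _ => A) x = 0 := by
  rw [lieTensor_eq, dirDeriv_const, jacobian_const_mulVec A hξ, Matrix.transpose_mul, hs, hA]
  noncomm_ring

namespace IsBiHamiltonian

variable {A : Matrix ι ι ℝ} {R : (ι → ℝ) → Matrix ι ι ℝ} {X : (ι → ℝ) → ι → ℝ}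

theorem smooth_tensor (h : IsBiHamiltonian A R) (m : ℕ) : SmoothMatrix fun x => R x ^ m * A :=
  (h.smooth.pow m).mul (smoothMatrix_const A)

/-- The vanishing of the Nijenhuis torsion, for arbitrary vector fields: `L_{RX} R = R L_X R`. -/
theorem lieEnd_mulVec (h : IsBiHamiltonian A R) (hX : ContDiff ℝ ∞ X) (x : ι → ℝ) :
    lieEnd (fun y => R y *ᵥ X y) R x = R x * lieEnd X R x := by
  refine matrix_ext_mulVec fun v => ?_
  have ht := h.torsion x (X x) v
  simp only [lieEnd, jacobian_mulVec_field h.smooth hX, Matrix.add_mulVec, Matrix.sub_mulVec,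
    mul_add, mul_sub, add_mul, ← Matrix.mulVec_mulVec, derivApply_mulVec, Matrix.mulVec_sub]
    at ht ⊢
  linear_combination (exp := 1) ht

/-- The closedness of `A⁻¹ R`, for arbitrary vector fields:
`L_{RX} A = (L_X A) Rᵀ - (L_X R) A`. -/
theorem lieTensor_mulVec (h : IsBiHamiltonian A R) (hX : ContDiff ℝ ∞ X) (x : ι → ℝ) :
    lieTensor (fun y => R y *ᵥ X y) (fun _ => A) x
      = lieTensor X (fun _ => A) x * (R x)ᵀ - lieEnd X R x * A := by
  have hc := h.closed x (X x)
  have hA := h.comm x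
  have h1 : A * (jacobian X x)ᵀ * (R x)ᵀ = A * (R x * jacobian X x)ᵀ := by
    rw [Matrix.transpose_mul, mul_assoc]
  simp only [lieTensor_eq, lieEnd, dirDeriv_const, jacobian_mulVec_field h.smooth hX,
    Matrix.transpose_add, sub_mul, add_mul, mul_add, h1, ← hc, mul_assoc, ← hA]
  noncomm_ring

theorem contDiff_pow_mulVec (h : IsBiHamiltonian A R) (hX : ContDiff ℝ ∞ X) (k : ℕ) :
    ContDiff ℝ ∞ fun y => R y ^ k *ᵥ X y :=
  (h.smooth.pow k).mulVec hX

theorem pow_succ_mulVec (X : (ι → ℝ) → ι → ℝ) (k : ℕ) :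
    (fun y => R y ^ (k + 1) *ᵥ X y) = fun y => R y *ᵥ (R y ^ k *ᵥ X y) := by
  funext y
  rw [Matrix.mulVec_mulVec, pow_succ']

theorem lieEnd_pow_mulVec (h : IsBiHamiltonian A R) (hX : ContDiff ℝ ∞ X) (k : ℕ) (x : ι → ℝ) :
    lieEnd (fun y => R y ^ k *ᵥ X y) R x = R x ^ k * lieEnd X R x := by
  induction k with
  | zero => simp
  | succ k ih =>
    rw [pow_succ_mulVec, h.lieEnd_mulVec (h.contDiff_pow_mulVec hX k), ih, pow_succ', mul_assoc]

theorem lieEnd_pow_mulVec_pow (h : IsBiHamiltonian A R) (hX : ContDiff ℝ ∞ X) (k m : ℕ)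
    (x : ι → ℝ) :
    lieEnd (fun y => R y ^ k *ᵥ X y) (fun y => R y ^ m) x
      = R x ^ k * lieEnd X (fun y => R y ^ m) x := by
  induction m with
  | zero => simp only [lieEnd_pow_zero, mul_zero]
  | succ m ih =>
    rw [lieEnd_pow_succ _ h.smooth, lieEnd_pow_succ _ h.smooth, ih, h.lieEnd_pow_mulVec hX]
    simp only [mul_add, ← mul_assoc, ← pow_add, add_comm]

/-- If `X` preserves `A`, then `L_{R^m X} A = -(L_X R^m) A`. -/
theorem lieTensor_pow_mulVec (h : IsBiHamiltonian A R) (hX : ContDiff ℝ ∞ X)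
    (hXA : ∀ x, lieTensor X (fun _ => A) x = 0) (m : ℕ) (x : ι → ℝ) :
    lieTensor (fun y => R y ^ m *ᵥ X y) (fun _ => A) x
      = -(lieEnd X (fun y => R y ^ m) x * A) := by
  induction m with
  | zero =>
    rw [lieEnd_pow_zero]
    simpa using hXA x
  | succ m ih =>
    rw [pow_succ_mulVec, h.lieTensor_mulVec (h.contDiff_pow_mulVec hX m), ih,
      h.lieEnd_pow_mulVec hX, lieEnd_pow_succ _ h.smooth, neg_mul, mul_assoc, ← h.comm]
    noncomm_ring

/-- `L_{R^k X} (R^m A)` for a vector field `X` preserving `A`. -/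
theorem lieTensor_pow_mulVec_pow_mul (h : IsBiHamiltonian A R) (hX : ContDiff ℝ ∞ X)
    (hXA : ∀ x, lieTensor X (fun _ => A) x = 0) (k m : ℕ) (x : ι → ℝ) :
    lieTensor (fun y => R y ^ k *ᵥ X y) (fun y => R y ^ m * A) x
      = R x ^ k * lieEnd X (fun y => R y ^ m) x * A
        - R x ^ m * (lieEnd X (fun y => R y ^ k) x * A) := by
  rw [lieTensor_mul _ (h.smooth.pow m) (smoothMatrix_const A), h.lieEnd_pow_mulVec_pow hX,
    h.lieTensor_pow_mulVec hX hXA, mul_neg, sub_eq_add_neg]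

/-- The Hamiltonian vector fields of each tensor `R^m A` preserve it. -/
theorem lieTensor_hamiltonian (h : IsBiHamiltonian A R) {ξ : (ι → ℝ) → ι → ℝ}
    (hξ : ContDiff ℝ ∞ ξ) (hs : ∀ x, (jacobian ξ x)ᵀ = jacobian ξ x) (m : ℕ) (x : ι → ℝ) :
    lieTensor (fun y => (R y ^ m * A) *ᵥ ξ y) (fun y => R y ^ m * A) x = 0 := by
  have hX : ContDiff ℝ ∞ fun y => A *ᵥ ξ y := (smoothMatrix_const A).mulVec hξ
  simp only [← Matrix.mulVec_mulVec]
  rw [h.lieTensor_pow_mulVec_pow_mul hX (lieTensor_const_mulVec h.skew hξ hs), mul_assoc,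
    sub_self]

section Conformal

variable {Z : ι → ℝ}

theorem lieEnd_conformal (hZ : IsConformal R Z) (x : ι → ℝ) :
    lieEnd (fun _ => Z) R x = R x := by
  simp [lieEnd, hZ x, jacobian_const]

theorem lieEnd_pow_conformal (h : IsBiHamiltonian A R) (hZ : IsConformal R Z) (m : ℕ)
    (x : ι → ℝ) : lieEnd (fun _ => Z) (fun y => R y ^ m) x = (m : ℝ) • R x ^ m := by
  induction m with
  | zero => simp only [lieEnd_pow_zero, Nat.cast_zero, zero_smul]
  | succ m ih =>
    rw [lieEnd_pow_succ _ h.smooth, ih, lieEnd_conformal hZ, smul_mul_assoc, ← pow_succ]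
    push_cast
    module

theorem lieTensor_const_const (A : Matrix ι ι ℝ) (Z x : ι → ℝ) :
    lieTensor (fun _ => Z) (fun _ => A) x = 0 := by
  simp [lieTensor_eq, dirDeriv_const, jacobian_const]

/-- The deformation relations for the hierarchy of tensors. -/
theorem lieTensor_master (h : IsBiHamiltonian A R) (hZ : IsConformal R Z) (k m : ℕ)
    (x : ι → ℝ) :
    lieTensor (fun y => R y ^ k *ᵥ Z) (fun y => R y ^ m * A) x
      = ((m : ℝ) - k) • (R x ^ (k + m) * A) := by
  rw [h.lieTensor_pow_mulVec_pow_mul (X := fun _ => Z) contDiff_const (lieTensor_const_const A Z),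
    h.lieEnd_pow_conformal hZ, h.lieEnd_pow_conformal hZ]
  simp only [mul_smul_comm, smul_mul_assoc, ← mul_assoc, ← pow_add, add_comm m k]
  module

theorem lieBracket_const_pow (h : IsBiHamiltonian A R) (hZ : IsConformal R Z) (m : ℕ)
    (x : ι → ℝ) :
    VectorField.lieBracket ℝ (fun _ => Z) (fun y => R y ^ m *ᵥ Z) x
      = (m : ℝ) • (R x ^ m *ᵥ Z) := by
  rw [lieBracket_mulVec (Y := fun _ => Z) contDiff_const contDiff_const (h.smooth.pow m),
    VectorField.lieBracket_self, h.lieEnd_pow_conformal hZ]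
  simp [Matrix.smul_mulVec]

/-- The deformation relations for the master symmetries themselves. -/
theorem lieBracket_master (h : IsBiHamiltonian A R) (hZ : IsConformal R Z) (k m : ℕ)
    (x : ι → ℝ) :
    VectorField.lieBracket ℝ (fun y => R y ^ k *ᵥ Z) (fun y => R y ^ m *ᵥ Z) x
      = ((m : ℝ) - k) • (R x ^ (k + m) *ᵥ Z) := by
  rw [lieBracket_mulVec (Y := fun _ => Z) (h.contDiff_pow_mulVec contDiff_const k) contDiff_const
      (h.smooth.pow m), h.lieEnd_pow_mulVec_pow (X := fun _ => Z) contDiff_const,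
    h.lieEnd_pow_conformal hZ, VectorField.lieBracket_swap, h.lieBracket_const_pow hZ]
  simp only [mul_smul_comm, Matrix.smul_mulVec, Matrix.mulVec_neg, Matrix.mulVec_smul,
    Matrix.mulVec_mulVec, ← pow_add, add_comm m k]
  module

end Conformal

section Flows

variable {ξ ξ' : (ι → ℝ) → ι → ℝ}

/-- A bi-Hamiltonian vector field preserves the recursion operator: if `A ξ' = R A ξ` with closed
forms `ξ`, `ξ'`, then both `A ξ` and `R A ξ` preserve `A`, and so `A ξ` preserves `R`. -/
theorem lieEnd_bihamiltonian (h : IsBiHamiltonian A R) (hξ : ContDiff ℝ ∞ ξ)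
    (hs : ∀ x, (jacobian ξ x)ᵀ = jacobian ξ x) (hξ' : ContDiff ℝ ∞ ξ')
    (hs' : ∀ x, (jacobian ξ' x)ᵀ = jacobian ξ' x)
    (he : ∀ x, A *ᵥ ξ' x = R x *ᵥ (A *ᵥ ξ x)) (x : ι → ℝ) :
    lieEnd (fun y => A *ᵥ ξ y) R x = 0 := by
  have h1 := h.lieTensor_mulVec ((smoothMatrix_const A).mulVec hξ) x
  rw [← funext he, lieTensor_const_mulVec h.skew hξ' hs', lieTensor_const_mulVec h.skew hξ hs,
    zero_mul, zero_sub, zero_eq_neg] at h1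
  have h2 := congrArg (· * A⁻¹) h1
  simpa [Matrix.mul_nonsing_inv_cancel_right _ _ h.isUnit_det] using h2

theorem lieEnd_pow_eq_zero (h : IsBiHamiltonian A R) (hX : ∀ x, lieEnd X R x = 0) (m : ℕ)
    (x : ι → ℝ) : lieEnd X (fun y => R y ^ m) x = 0 := by
  induction m with
  | zero => exact lieEnd_pow_zero X R x
  | succ m ih => rw [lieEnd_pow_succ _ h.smooth, ih, hX, zero_mul, mul_zero, add_zero]

/-- The flows generated from a vector field preserving `R` commute. -/
theorem lieBracket_flows (h : IsBiHamiltonian A R) (hX : ContDiff ℝ ∞ X)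
    (h0 : ∀ x, lieEnd X R x = 0) (k m : ℕ) (x : ι → ℝ) :
    VectorField.lieBracket ℝ (fun y => R y ^ k *ᵥ X y) (fun y => R y ^ m *ᵥ X y) x = 0 := by
  rw [lieBracket_mulVec (h.contDiff_pow_mulVec hX k) hX (h.smooth.pow m),
    h.lieEnd_pow_mulVec_pow hX, h.lieEnd_pow_eq_zero h0, VectorField.lieBracket_swap,
    lieBracket_mulVec hX hX (h.smooth.pow k), h.lieEnd_pow_eq_zero h0,
    VectorField.lieBracket_self]
  simp

/-- The bracket of a master symmetry with a flow of the hierarchy. -/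
theorem lieBracket_master_flow (h : IsBiHamiltonian A R) {Z : ι → ℝ} (hZ : IsConformal R Z)
    (hX : ContDiff ℝ ∞ X) (h0 : ∀ x, lieEnd X R x = 0)
    (h1 : ∀ x, VectorField.lieBracket ℝ (fun _ => Z) X x = X x) (k m : ℕ) (x : ι → ℝ) :
    VectorField.lieBracket ℝ (fun y => R y ^ k *ᵥ Z) (fun y => R y ^ m *ᵥ X y) x
      = ((m : ℝ) + 1) • (R x ^ (k + m) *ᵥ X x) := by
  have hZc : ContDiff ℝ ∞ fun _ : ι → ℝ => Z := contDiff_const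
  rw [lieBracket_mulVec (h.contDiff_pow_mulVec hZc k) hX (h.smooth.pow m),
    h.lieEnd_pow_mulVec_pow hZc, h.lieEnd_pow_conformal hZ, VectorField.lieBracket_swap,
    lieBracket_mulVec hX hZc (h.smooth.pow k), h.lieEnd_pow_eq_zero h0,
    VectorField.lieBracket_swap, h1]
  simp only [mul_smul_comm, Matrix.smul_mulVec, Matrix.mulVec_neg, Matrix.zero_mulVec, zero_add,
    neg_neg, Matrix.mulVec_mulVec, ← pow_add, add_comm m k]
  module

end Flows

end IsBiHamiltonian

end BiHamiltonian

/-! ### Projection along smooth maps -/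

section Transport

variable {ι κ : Type*} [Fintype ι] [DecidableEq ι] [Fintype κ] [DecidableEq κ]
  {Φ : (ι → ℝ) → κ → ℝ}

/-- The derivative of `Y ∘ Φ = dΦ(X)`, using that the second derivative of `Φ` is symmetric. -/
theorem MapsField.jacobian_mul (hΦ : ContDiff ℝ ∞ Φ) {X : (ι → ℝ) → ι → ℝ}
    {Y : (κ → ℝ) → κ → ℝ} (hX : ContDiff ℝ ∞ X) (hY : ContDiff ℝ ∞ Y) (h : MapsField Φ X Y)
    (x : ι → ℝ) :
    jacobian Y (Φ x) * jacobian Φ x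
      = dirDeriv (jacobian Φ) x (X x) + jacobian Φ x * jacobian X x := by
  rw [← jacobian_comp hY hΦ, funext h, jacobian_mulVec_field (smoothMatrix_jacobian hΦ) hX,
    derivApply_jacobian hΦ]

/-- Lie derivatives of tensors are natural with respect to smooth maps. -/
theorem MapsTensor.lieTensor (hΦ : ContDiff ℝ ∞ Φ) {X : (ι → ℝ) → ι → ℝ}
    {Y : (κ → ℝ) → κ → ℝ} (hX : ContDiff ℝ ∞ X) (hY : ContDiff ℝ ∞ Y)
    {P : (ι → ℝ) → Matrix ι ι ℝ} {Q : (κ → ℝ) → Matrix κ κ ℝ} (hP : SmoothMatrix P)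
    (hQ : SmoothMatrix Q) (hXY : MapsField Φ X Y) (hPQ : MapsTensor Φ P Q) :
    MapsTensor Φ (lieTensor X P) (lieTensor Y Q) := by
  intro x
  have hJ := smoothMatrix_jacobian hΦ
  have h1 := hXY.jacobian_mul hΦ hX hY x
  have h2 : dirDeriv Q (Φ x) (Y (Φ x)) = dirDeriv (jacobian Φ) x (X x) * P x * (jacobian Φ x)ᵀ
      + jacobian Φ x * dirDeriv P x (X x) * (jacobian Φ x)ᵀ
      + jacobian Φ x * P x * (dirDeriv (jacobian Φ) x (X x))ᵀ := by
    rw [hXY x, ← dirDeriv_comp hQ hΦ, funext hPQ, dirDeriv_mul (hJ.mul hP) hJ.transpose,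
      dirDeriv_mul hJ hP, dirDeriv_transpose, Matrix.add_mul]
  have h3 : jacobian Y (Φ x) * Q (Φ x) = (jacobian Y (Φ x) * jacobian Φ x) * P x
      * (jacobian Φ x)ᵀ := by
    simp only [hPQ x, Matrix.mul_assoc]
  have h4 : Q (Φ x) * (jacobian Y (Φ x))ᵀ = jacobian Φ x * P x
      * (jacobian Y (Φ x) * jacobian Φ x)ᵀ := by
    simp only [hPQ x, Matrix.transpose_mul, Matrix.mul_assoc]
  rw [lieTensor_eq, lieTensor_eq, h2, h3, h4, h1, Matrix.transpose_add, Matrix.transpose_mul]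
  simp only [Matrix.add_mul, Matrix.mul_add, Matrix.sub_mul, Matrix.mul_sub, Matrix.mul_assoc]
  abel

/-- Lie brackets of vector fields are natural with respect to smooth maps. -/
theorem MapsField.lieBracket (hΦ : ContDiff ℝ ∞ Φ) {X X' : (ι → ℝ) → ι → ℝ}
    {Y Y' : (κ → ℝ) → κ → ℝ} (hX : ContDiff ℝ ∞ X) (hY : ContDiff ℝ ∞ Y)
    (hX' : ContDiff ℝ ∞ X') (hY' : ContDiff ℝ ∞ Y') (h : MapsField Φ X Y)
    (h' : MapsField Φ X' Y') :
    MapsField Φ (VectorField.lieBracket ℝ X X') (VectorField.lieBracket ℝ Y Y') := by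
  intro x
  have hsymm : dirDeriv (jacobian Φ) x (X' x) *ᵥ X x = dirDeriv (jacobian Φ) x (X x) *ᵥ X' x := by
    rw [← derivApply_jacobian hΦ, derivApply_mulVec]
  rw [lieBracket_eq hX hX', lieBracket_eq hY hY', h x, h' x, Matrix.mulVec_mulVec,
    Matrix.mulVec_mulVec, h.jacobian_mul hΦ hX hY, h'.jacobian_mul hΦ hX' hY']
  simp only [Matrix.add_mulVec, Matrix.mulVec_sub, hsymm, Matrix.mulVec_mulVec]
  abel

/-- The derivative of a function along a projected vector field. -/
theorem MapsField.lieFun (hΦ : ContDiff ℝ ∞ Φ) {X : (ι → ℝ) → ι → ℝ} {Y : (κ → ℝ) → κ → ℝ}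
    (h : MapsField Φ X Y) {f : (κ → ℝ) → ℝ} (hf : ContDiff ℝ ∞ f) (x : ι → ℝ) :
    lieFun Y f (Φ x) = lieFun X (fun y => f (Φ y)) x := by
  rw [KM.lieFun, KM.lieFun, fderiv_eq_dotProduct, fderiv_eq_dotProduct, h x,
    differential_comp hf hΦ, Matrix.mulVec_transpose, ← Matrix.dotProduct_mulVec]

/-- Hamiltonian vector fields of pulled back functions project. -/
theorem MapsTensor.hamField (hΦ : ContDiff ℝ ∞ Φ) {P : (ι → ℝ) → Matrix ι ι ℝ}
    {Q : (κ → ℝ) → Matrix κ κ ℝ} (h : MapsTensor Φ P Q) {f : (κ → ℝ) → ℝ}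
    (hf : ContDiff ℝ ∞ f) :
    MapsField Φ (hamField P fun y => f (Φ y)) (hamField Q f) := by
  intro x
  rw [KM.hamField, KM.hamField, h x, differential_comp hf hΦ]
  simp only [Matrix.mulVec_mulVec, Matrix.mul_assoc]

theorem MapsTensor.bracket (hΦ : ContDiff ℝ ∞ Φ) {P : (ι → ℝ) → Matrix ι ι ℝ}
    {Q : (κ → ℝ) → Matrix κ κ ℝ} (h : MapsTensor Φ P Q) {f g : (κ → ℝ) → ℝ}
    (hf : ContDiff ℝ ∞ f) (hg : ContDiff ℝ ∞ g) (x : ι → ℝ) :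
    bracket Q f g (Φ x) = bracket P (fun y => f (Φ y)) (fun y => g (Φ y)) x := by
  rw [KM.bracket, KM.bracket, h.hamField hΦ hg x, differential_comp hf hΦ,
    Matrix.mulVec_transpose, ← Matrix.dotProduct_mulVec]

theorem contDiff_apply_coord (i : ι) : ContDiff ℝ ∞ fun x : ι → ℝ => x i :=
  contDiff_apply ℝ ℝ i

theorem differential_coord (i : ι) (x : ι → ℝ) :
    differential (fun y => y i) x = Pi.single i 1 := by
  ext l
  change fderiv ℝ (ContinuousLinearMap.proj (R := ℝ) (φ := fun _ : ι => ℝ) i) x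
    (Pi.single l 1) = _
  rw [ContinuousLinearMap.fderiv]
  simp [Pi.single_apply, eq_comm]

theorem SmoothMatrix.hamField {P : (ι → ℝ) → Matrix ι ι ℝ} (hP : SmoothMatrix P)
    {f : (ι → ℝ) → ℝ} (hf : ContDiff ℝ ∞ f) : ContDiff ℝ ∞ (hamField P f) :=
  hP.mulVec (contDiff_differential hf)

/-- The Jacobi identity says that the Hamiltonian vector fields of the coordinate functions
preserve the tensor. -/
theorem isPoissonOn_of_lieTensor {P : (ι → ℝ) → Matrix ι ι ℝ} {U : Set (ι → ℝ)}
    (hP : SmoothMatrix P) (hs : ∀ x, (P x)ᵀ = -P x)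
    (h : ∀ x ∈ U, ∀ i, lieTensor (hamField P fun y => y i) P x = 0) : IsPoissonOn P U where
  smooth i j := (hP i j).contDiffOn
  skew x _ := hs x
  jacobi x hx i j k := by
    -- `h` for the `i`-th coordinate is minus the Jacobi identity, up to the skew-symmetry of `P`
    have hs' : ∀ y a b, P y a b = -P y b a := fun y a b => by
      simpa using congrFun (congrFun (hs y) b) a
    have hX : hamField P (fun y => y i) = fun y l => P y l i := by
      funext y l
      rw [hamField, differential_coord, Matrix.mulVec_single_one]
      rfl
    have hD : ∀ a b, (fun y => P y a b) = fun y => -P y b a := fun a b => funext fun y => hs' y a b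
    have hpart : ∀ a b l, partialD (fun y => P y a b) l x = -partialD (fun y => P y b a) l x := by
      intro a b l
      rw [hD a b, partialD, fderiv_fun_neg]
      rfl
    have h0 := congrFun (congrFun (h x hx i) j) k
    rw [hX] at h0
    simp only [lieTensor, lieFun, Matrix.of_apply, fderiv_eq_sum_partialD, Matrix.zero_apply,
      ← Finset.sum_sub_distrib] at h0
    rw [← neg_eq_zero, ← h0, ← Finset.sum_neg_distrib]
    refine Finset.sum_congr rfl fun l _ => ?_
    rw [hs' x l i, hs' x l k, hpart j i]
    ring

/-- A projection of a tensor whose Hamiltonian vector fields preserve it is Poisson. -/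
theorem MapsTensor.isPoissonOn_range (hΦ : ContDiff ℝ ∞ Φ) {P : (ι → ℝ) → Matrix ι ι ℝ}
    {Q : (κ → ℝ) → Matrix κ κ ℝ} (hP : SmoothMatrix P) (hQ : SmoothMatrix Q)
    (hs : ∀ x, (Q x)ᵀ = -Q x) (hPQ : MapsTensor Φ P Q)
    (h : ∀ f, ContDiff ℝ ∞ f → ∀ x, KM.lieTensor (KM.hamField P f) P x = 0) :
    IsPoissonOn Q (Set.range Φ) := by
  refine isPoissonOn_of_lieTensor hQ hs ?_
  rintro _ ⟨x, rfl⟩ i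
  have hi := contDiff_apply_coord (ι := κ) i
  have hi' : ContDiff ℝ ∞ fun y => Φ y i := hi.comp hΦ
  rw [MapsTensor.lieTensor hΦ (hP.hamField hi') (hQ.hamField hi) hP hQ
    (hPQ.hamField hΦ hi) hPQ x, h _ hi', Matrix.mul_zero, Matrix.zero_mul]

end Transport

/-! ### The matrices of the KM hierarchy -/

/-- The matrix reading off the left end point `q_k` of the edge `k = (k, k + 1)`. -/
def leftEnd (n : ℕ) : Matrix (Fin (2 * n + 1)) (Fin (2 * n + 2)) ℝ :=
  Matrix.of fun k i => if i = k.castSucc then 1 else 0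

/-- The matrix reading off the right end point `q_{k+1}` of the edge `k = (k, k + 1)`. -/
def rightEnd (n : ℕ) : Matrix (Fin (2 * n + 1)) (Fin (2 * n + 2)) ℝ :=
  Matrix.of fun k i => if i = k.succ then 1 else 0

/-- The constant matrix of the tensor `w_2`. -/
def signMatrix (n : ℕ) : Matrix (Fin (2 * n + 2)) (Fin (2 * n + 2)) ℝ :=
  Matrix.of fun i j => if i < j then 1 else if j < i then -1 else 0

/-- The skew-symmetric tridiagonal matrix with entries `a_k` above the diagonal, that is, the
matrix of the 2-form `∑ a_k dq_k ∧ dq_{k+1}`. -/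
def skewTri (n : ℕ) (a : Fin (2 * n + 1) → ℝ) : Matrix (Fin (2 * n + 2)) (Fin (2 * n + 2)) ℝ :=
  (leftEnd n)ᵀ * Matrix.diagonal a * rightEnd n - (rightEnd n)ᵀ * Matrix.diagonal a * leftEnd n

/-- The recursion operator as a function of `a = G(q)`. -/
def recA (n : ℕ) (a : Fin (2 * n + 1) → ℝ) : Matrix (Fin (2 * n + 2)) (Fin (2 * n + 2)) ℝ :=
  -(signMatrix n * skewTri n a)

section EdgeMatrices

variable {n : ℕ} {μ : Type*}

@[simp] theorem leftEnd_mulVec (v : Fin (2 * n + 2) → ℝ) (k : Fin (2 * n + 1)) :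
    (leftEnd n *ᵥ v) k = v k.castSucc := by
  simp [leftEnd, Matrix.mulVec, dotProduct]

@[simp] theorem rightEnd_mulVec (v : Fin (2 * n + 2) → ℝ) (k : Fin (2 * n + 1)) :
    (rightEnd n *ᵥ v) k = v k.succ := by
  simp [rightEnd, Matrix.mulVec, dotProduct]

@[simp] theorem leftEnd_mul_apply (M : Matrix (Fin (2 * n + 2)) μ ℝ) (k : Fin (2 * n + 1))
    (j : μ) : (leftEnd n * M) k j = M k.castSucc j := by
  simp [leftEnd, Matrix.mul_apply]

@[simp] theorem rightEnd_mul_apply (M : Matrix (Fin (2 * n + 2)) μ ℝ) (k : Fin (2 * n + 1))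
    (j : μ) : (rightEnd n * M) k j = M k.succ j := by
  simp [rightEnd, Matrix.mul_apply]

@[simp] theorem mul_leftEnd_transpose_apply (M : Matrix μ (Fin (2 * n + 2)) ℝ) (i : μ)
    (k : Fin (2 * n + 1)) : (M * (leftEnd n)ᵀ) i k = M i k.castSucc := by
  simp [leftEnd, Matrix.mul_apply]

@[simp] theorem mul_rightEnd_transpose_apply (M : Matrix μ (Fin (2 * n + 2)) ℝ) (i : μ)
    (k : Fin (2 * n + 1)) : (M * (rightEnd n)ᵀ) i k = M i k.succ := by
  simp [rightEnd, Matrix.mul_apply]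

theorem signMatrix_transpose (n : ℕ) : (signMatrix n)ᵀ = -signMatrix n := by
  ext i j
  simp only [signMatrix, Matrix.transpose_apply, Matrix.of_apply, Matrix.neg_apply]
  split_ifs <;> first | omega | simp

theorem skewTri_transpose (a : Fin (2 * n + 1) → ℝ) : (skewTri n a)ᵀ = -skewTri n a := by
  simp [skewTri, Matrix.transpose_mul, Matrix.mul_assoc]

/-- Taking differences along the edges turns the nonlocal matrix `w_2` into a local one. -/
theorem diff_mul_signMatrix (n : ℕ) :
    (leftEnd n - rightEnd n) * signMatrix n = leftEnd n + rightEnd n := by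
  ext k j
  rw [Matrix.sub_mul, Matrix.sub_apply, leftEnd_mul_apply, rightEnd_mul_apply]
  simp only [signMatrix, leftEnd, rightEnd, Matrix.of_apply, Matrix.add_apply, Fin.lt_def,
    Fin.ext_iff, Fin.val_castSucc, Fin.val_succ]
  split_ifs <;> first | omega | norm_num

theorem signMatrix_mul_diff_transpose (n : ℕ) :
    signMatrix n * (leftEnd n - rightEnd n)ᵀ = -(leftEnd n + rightEnd n)ᵀ := by
  rw [← diff_mul_signMatrix, Matrix.transpose_mul, signMatrix_transpose]
  simp

/-- A vector in the kernel alternates along the edges; as the number of edges is odd, the first row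
then forces it to vanish. -/
theorem isUnit_signMatrix_det (n : ℕ) : IsUnit (signMatrix n).det := by
  rw [← Matrix.isUnit_iff_isUnit_det, ← Matrix.mulVec_injective_iff_isUnit]
  refine (injective_iff_map_eq_zero (Matrix.mulVecLin (signMatrix n)).toAddMonoidHom).2 ?_
  intro v hv
  replace hv : signMatrix n *ᵥ v = 0 := hv
  have h1 : ∀ k : Fin (2 * n + 1), v k.castSucc + v k.succ = 0 := by
    intro k
    have := congrFun (congrArg ((leftEnd n - rightEnd n) *ᵥ ·) hv) k
    simpa [Matrix.mulVec_mulVec, diff_mul_signMatrix, Matrix.add_mulVec] using this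
  have halt : ∀ i : Fin (2 * n + 2), v i = (-1) ^ (i : ℕ) * v 0 := by
    intro i
    induction i using Fin.induction with
    | zero => simp
    | succ k ih =>
      have := h1 k
      rw [ih, Fin.val_castSucc] at this
      rw [Fin.val_succ, pow_succ]
      linarith
  have h0 : ∑ k : Fin (2 * n + 1), v k.succ = 0 := by
    have := congrFun hv 0
    rw [Matrix.mulVec, dotProduct, Fin.sum_univ_succ] at this
    simpa [signMatrix] using this
  have hsum : ∑ k : Fin (2 * n + 1), v k.succ = -v 0 := by
    have : ∀ k : Fin (2 * n + 1), v k.succ = -v 0 * (-1) ^ (k : ℕ) := fun k => by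
      rw [halt, Fin.val_succ, pow_succ]; ring
    simp only [this]
    rw [← Finset.mul_sum, Fin.sum_univ_eq_sum_range fun k => (-1 : ℝ) ^ k,
      neg_one_geom_sum, if_neg (by simp), mul_one]
  have hv0 : v 0 = 0 := by linarith
  ext i
  rw [halt, hv0, mul_zero, Pi.zero_apply]

theorem skewTri_apply (a : Fin (2 * n + 1) → ℝ) (i j : Fin (2 * n + 2)) :
    skewTri n a i j =
      ∑ k, a k * (leftEnd n k i * rightEnd n k j - rightEnd n k i * leftEnd n k j) := by
  rw [skewTri, Matrix.sub_apply, Matrix.mul_apply, Matrix.mul_apply, ← Finset.sum_sub_distrib]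
  simp only [Matrix.mul_diagonal, Matrix.transpose_apply]
  exact Finset.sum_congr rfl fun k _ => by ring

theorem skewTri_mulVec (a : Fin (2 * n + 1) → ℝ) (v : Fin (2 * n + 2) → ℝ) :
    skewTri n a *ᵥ v = (leftEnd n)ᵀ *ᵥ (a * (rightEnd n *ᵥ v))
      - (rightEnd n)ᵀ *ᵥ (a * (leftEnd n *ᵥ v)) := by
  have hd : ∀ u, Matrix.diagonal a *ᵥ u = a * u := fun u => by
    ext k; simp [Matrix.mulVec_diagonal]
  rw [skewTri, Matrix.sub_mulVec]
  simp only [← Matrix.mulVec_mulVec, hd]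

end EdgeMatrices

section ZeroExtension

variable {m : ℕ}

/-- The extension of a vector by zero to a function on the integers; it encodes the conventions
`a_0 = a_N = 0` and turns identities between neighbouring coordinates into polynomial ones. -/
def zeroExt (v : Fin m → ℝ) (i : ℤ) : ℝ :=
  if h : 0 ≤ i ∧ i < m then v ⟨i.toNat, by omega⟩ else 0

@[simp] theorem zeroExt_coe (v : Fin m → ℝ) (i : Fin m) : zeroExt v (i : ℕ) = v i := by
  have : 0 ≤ ((i : ℕ) : ℤ) ∧ ((i : ℕ) : ℤ) < m := by omega
  rw [zeroExt, dif_pos this]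
  rfl

theorem zeroExt_of_not_mem (v : Fin m → ℝ) {i : ℤ} (h : ¬ (0 ≤ i ∧ i < m)) : zeroExt v i = 0 :=
  dif_neg h

theorem exists_coe_or_not_mem (m : ℕ) (i : ℤ) :
    (∃ k : Fin m, i = ((k : ℕ) : ℤ)) ∨ ¬ (0 ≤ i ∧ i < m) := by
  by_cases h : 0 ≤ i ∧ i < m
  · exact Or.inl ⟨⟨i.toNat, by omega⟩, by simp [h.1]⟩
  · exact Or.inr h

theorem zeroExt_injective {v v' : Fin m → ℝ} (h : ∀ i, zeroExt v i = zeroExt v' i) : v = v' := by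
  ext i
  simpa using h (i : ℕ)

theorem zeroExt_add (v v' : Fin m → ℝ) (i : ℤ) :
    zeroExt (v + v') i = zeroExt v i + zeroExt v' i := by
  unfold zeroExt; split_ifs <;> simp

theorem zeroExt_sub (v v' : Fin m → ℝ) (i : ℤ) :
    zeroExt (v - v') i = zeroExt v i - zeroExt v' i := by
  unfold zeroExt; split_ifs <;> simp

theorem zeroExt_mul (v v' : Fin m → ℝ) (i : ℤ) :
    zeroExt (v * v') i = zeroExt v i * zeroExt v' i := by
  unfold zeroExt; split_ifs <;> simp

variable {n : ℕ}

theorem zeroExt_castSucc (v : Fin (2 * n + 2) → ℝ) (k : Fin (2 * n + 1)) :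
    zeroExt v ((k : ℕ) : ℤ) = v k.castSucc :=
  zeroExt_coe v k.castSucc

theorem zeroExt_succ (v : Fin (2 * n + 2) → ℝ) (k : Fin (2 * n + 1)) :
    zeroExt v (((k : ℕ) : ℤ) + 1) = v k.succ := by
  rw [← zeroExt_coe v k.succ, Fin.val_succ]
  push_cast
  rfl

theorem zeroExt_leftEnd_transpose (g : Fin (2 * n + 1) → ℝ) (i : ℤ) :
    zeroExt ((leftEnd n)ᵀ *ᵥ g) i = zeroExt g i := by
  rcases exists_coe_or_not_mem (2 * n + 2) i with ⟨k, rfl⟩ | h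
  · rw [zeroExt_coe]
    refine Fin.lastCases ?_ (fun k => ?_) k
    · rw [zeroExt_of_not_mem g (by simp)]
      simp [Matrix.mulVec, dotProduct, leftEnd, (Fin.castSucc_lt_last _).ne']
    · rw [Fin.val_castSucc, zeroExt_coe]
      simp [Matrix.mulVec, dotProduct, leftEnd]
  · rw [zeroExt_of_not_mem _ h, zeroExt_of_not_mem _ (by omega)]

theorem zeroExt_rightEnd_transpose (g : Fin (2 * n + 1) → ℝ) (i : ℤ) :
    zeroExt ((rightEnd n)ᵀ *ᵥ g) i = zeroExt g (i - 1) := by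
  rcases exists_coe_or_not_mem (2 * n + 2) i with ⟨k, rfl⟩ | h
  · rw [zeroExt_coe]
    refine Fin.cases ?_ (fun k => ?_) k
    · rw [zeroExt_of_not_mem g (by simp)]
      simp [Matrix.mulVec, dotProduct, rightEnd, (Fin.succ_ne_zero _).symm]
    · rw [Fin.val_succ, Nat.cast_succ, add_sub_cancel_right, zeroExt_coe]
      simp [Matrix.mulVec, dotProduct, rightEnd]
  · rw [zeroExt_of_not_mem _ h, zeroExt_of_not_mem _ (by omega)]

/-- The factor `a_k` makes the restriction to edges unnecessary. -/
theorem zeroExt_mul_leftEnd (a : Fin (2 * n + 1) → ℝ) (v : Fin (2 * n + 2) → ℝ) (i : ℤ) :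
    zeroExt a i * zeroExt (leftEnd n *ᵥ v) i = zeroExt a i * zeroExt v i := by
  rcases exists_coe_or_not_mem (2 * n + 1) i with ⟨k, rfl⟩ | h
  · rw [zeroExt_coe, zeroExt_coe, zeroExt_castSucc, leftEnd_mulVec]
  · rw [zeroExt_of_not_mem a h, zero_mul, zero_mul]

theorem zeroExt_mul_rightEnd (a : Fin (2 * n + 1) → ℝ) (v : Fin (2 * n + 2) → ℝ) (i : ℤ) :
    zeroExt a i * zeroExt (rightEnd n *ᵥ v) i = zeroExt a i * zeroExt v (i + 1) := by
  rcases exists_coe_or_not_mem (2 * n + 1) i with ⟨k, rfl⟩ | h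
  · rw [zeroExt_coe, zeroExt_coe, zeroExt_succ, rightEnd_mulVec]
  · rw [zeroExt_of_not_mem a h, zero_mul, zero_mul]

theorem zeroExt_skewTri (a : Fin (2 * n + 1) → ℝ) (v : Fin (2 * n + 2) → ℝ) (i : ℤ) :
    zeroExt (skewTri n a *ᵥ v) i
      = zeroExt a i * zeroExt v (i + 1) - zeroExt a (i - 1) * zeroExt v (i - 1) := by
  rw [skewTri_mulVec, zeroExt_sub, zeroExt_leftEnd_transpose, zeroExt_rightEnd_transpose,
    zeroExt_mul, zeroExt_mul, zeroExt_mul_leftEnd, zeroExt_mul_rightEnd]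

/-- The algebraic identity behind the vanishing of the torsion of the recursion operator. -/
theorem skewTri_torsion (a : Fin (2 * n + 1) → ℝ) (x y : Fin (2 * n + 2) → ℝ) :
    skewTri n (a * ((leftEnd n + rightEnd n) *ᵥ (skewTri n a *ᵥ x))) *ᵥ y
      - skewTri n (a * ((leftEnd n + rightEnd n) *ᵥ (skewTri n a *ᵥ y))) *ᵥ x
      = skewTri n a *ᵥ ((leftEnd n + rightEnd n)ᵀ *ᵥ (a * ((leftEnd n *ᵥ y) * (rightEnd n *ᵥ x)
        - (leftEnd n *ᵥ x) * (rightEnd n *ᵥ y)))) := by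
  have hm : ∀ u v : Fin (2 * n + 2) → ℝ, ∀ i,
      zeroExt a i * (zeroExt (leftEnd n *ᵥ u) i * zeroExt (rightEnd n *ᵥ v) i)
        = zeroExt a i * (zeroExt u i * zeroExt v (i + 1)) := fun u v i => by
    rw [← mul_assoc, zeroExt_mul_leftEnd, mul_right_comm, zeroExt_mul_rightEnd]
    ring
  apply zeroExt_injective
  intro i
  simp only [zeroExt_sub, zeroExt_skewTri, zeroExt_mul, zeroExt_add, Matrix.add_mulVec, mul_add,
    mul_sub, Matrix.transpose_add, zeroExt_leftEnd_transpose, zeroExt_rightEnd_transpose, hm,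
    sub_add_cancel, add_sub_cancel_right]
  simp only [zeroExt_mul_leftEnd, zeroExt_mul_rightEnd, zeroExt_skewTri, sub_add_cancel,
    add_sub_cancel_right]
  ring

end ZeroExtension

/-! ### The recursion operator of the KM hierarchy -/

section RecursionOperator

variable {n : ℕ}

theorem skewTri_neg (a : Fin (2 * n + 1) → ℝ) : skewTri n (-a) = -skewTri n a := by
  ext i j
  simp only [skewTri_apply, Matrix.neg_apply, ← Finset.sum_neg_distrib, Pi.neg_apply, neg_mul]

theorem contDiff_linear_sum {ι : Type*} [Fintype ι] (c : ι → ℝ) :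
    ContDiff ℝ ∞ fun a : ι → ℝ => ∑ k, a k * c k :=
  ContDiff.sum fun k _ => (contDiff_apply ℝ ℝ k).mul contDiff_const

theorem fderiv_linear_sum {ι : Type*} [Fintype ι] [DecidableEq ι] (c : ι → ℝ) (a v : ι → ℝ) :
    fderiv ℝ (fun a : ι → ℝ => ∑ k, a k * c k) a v = ∑ k, v k * c k := by
  have h : (fun a : ι → ℝ => ∑ k, a k * c k)
      = ∑ k, c k • ContinuousLinearMap.proj (R := ℝ) (φ := fun _ : ι => ℝ) k := by
    funext a
    simp [mul_comm]
  rw [h, ContinuousLinearMap.fderiv]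
  simp [mul_comm]

theorem smoothMatrix_skewTri (n : ℕ) : SmoothMatrix (skewTri n) := by
  intro i j
  simp only [skewTri_apply]
  exact contDiff_linear_sum _

theorem dirDeriv_skewTri (a v : Fin (2 * n + 1) → ℝ) :
    dirDeriv (skewTri n) a v = skewTri n v := by
  ext i j
  simp only [dirDeriv, skewTri_apply, Matrix.of_apply]
  exact fderiv_linear_sum _ a v

theorem recA_eq (n : ℕ) : recA n = fun a => -signMatrix n * skewTri n a := by
  funext a
  rw [recA, neg_mul]

theorem recA_mulVec (a : Fin (2 * n + 1) → ℝ) (v : Fin (2 * n + 2) → ℝ) :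
    recA n a *ᵥ v = -(signMatrix n *ᵥ (skewTri n a *ᵥ v)) := by
  rw [recA, Matrix.neg_mulVec, Matrix.mulVec_mulVec]

theorem smoothMatrix_recA (n : ℕ) : SmoothMatrix (recA n) := by
  rw [recA_eq]
  exact (smoothMatrix_const _).mul (smoothMatrix_skewTri n)

theorem dirDeriv_recA (a v : Fin (2 * n + 1) → ℝ) : dirDeriv (recA n) a v = recA n v := by
  rw [recA_eq, dirDeriv_mul (smoothMatrix_const _) (smoothMatrix_skewTri n), dirDeriv_const,
    dirDeriv_skewTri, zero_mul, zero_add]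

theorem contDiff_G (n : ℕ) : ContDiff ℝ ∞ (G n) := by
  rw [contDiff_pi]
  intro k
  exact Real.contDiff_exp.comp ((contDiff_apply ℝ ℝ _).sub (contDiff_apply ℝ ℝ _))

theorem jacobian_G (q : Fin (2 * n + 2) → ℝ) :
    jacobian (G n) q = Matrix.diagonal (G n q) * (leftEnd n - rightEnd n) := by
  ext k i
  have h : HasFDerivAt (fun y : Fin (2 * n + 2) → ℝ => Real.exp (y k.castSucc - y k.succ))
      (Real.exp (q k.castSucc - q k.succ) •
        (ContinuousLinearMap.proj (R := ℝ) (φ := fun _ : Fin (2 * n + 2) => ℝ) k.castSucc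
          - ContinuousLinearMap.proj (R := ℝ) (φ := fun _ : Fin (2 * n + 2) => ℝ) k.succ)) q :=
    ((hasFDerivAt_apply k.castSucc q).sub (hasFDerivAt_apply k.succ q)).exp
  rw [jacobian, Matrix.of_apply, partialD]
  change fderiv ℝ (fun y : Fin (2 * n + 2) → ℝ => Real.exp (y k.castSucc - y k.succ)) q _ = _
  rw [h.fderiv]
  simp [G, leftEnd, rightEnd, Pi.single_apply, eq_comm]

theorem jacobian_G_mulVec (q v : Fin (2 * n + 2) → ℝ) :
    jacobian (G n) q *ᵥ v = G n q * ((leftEnd n - rightEnd n) *ᵥ v) := by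
  rw [jacobian_G, ← Matrix.mulVec_mulVec]
  ext k
  simp [Matrix.mulVec_diagonal]

theorem dirDeriv_recA_G (q v : Fin (2 * n + 2) → ℝ) :
    dirDeriv (fun y => recA n (G n y)) q v = recA n (G n q * ((leftEnd n - rightEnd n) *ᵥ v)) := by
  rw [dirDeriv_comp (smoothMatrix_recA n) (contDiff_G n), dirDeriv_recA, jacobian_G_mulVec]

/-- The 2-form with matrix `skewTri (G q)` is closed. -/
theorem skewTri_closed (a : Fin (2 * n + 1) → ℝ) (u v : Fin (2 * n + 2) → ℝ) :
    skewTri n (a * ((leftEnd n - rightEnd n) *ᵥ u)) *ᵥ v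
      - skewTri n (a * ((leftEnd n - rightEnd n) *ᵥ v)) *ᵥ u
      = (leftEnd n - rightEnd n)ᵀ *ᵥ (a * ((leftEnd n *ᵥ u) * (rightEnd n *ᵥ v)
        - (leftEnd n *ᵥ v) * (rightEnd n *ᵥ u))) := by
  simp only [skewTri_mulVec, Matrix.sub_mulVec, Matrix.transpose_sub]
  rw [sub_sub_sub_comm, ← Matrix.mulVec_sub, ← Matrix.mulVec_sub]
  congr 2 <;> ring

/-- The matrix of `v ↦ (D_v C) u`, where `C = skewTri (G q)`. -/
def skewTriDeriv (n : ℕ) (a : Fin (2 * n + 1) → ℝ) (u : Fin (2 * n + 2) → ℝ) :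
    Matrix (Fin (2 * n + 2)) (Fin (2 * n + 2)) ℝ :=
  ((leftEnd n)ᵀ * Matrix.diagonal (a * (rightEnd n *ᵥ u))
    - (rightEnd n)ᵀ * Matrix.diagonal (a * (leftEnd n *ᵥ u))) * (leftEnd n - rightEnd n)

theorem skewTriDeriv_mulVec (a : Fin (2 * n + 1) → ℝ) (u v : Fin (2 * n + 2) → ℝ) :
    skewTriDeriv n a u *ᵥ v = skewTri n (a * ((leftEnd n - rightEnd n) *ᵥ v)) *ᵥ u := by
  have hd : ∀ b c : Fin (2 * n + 1) → ℝ, Matrix.diagonal b *ᵥ c = b * c := fun b c => by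
    ext k; simp [Matrix.mulVec_diagonal]
  simp only [skewTriDeriv, ← Matrix.mulVec_mulVec, Matrix.sub_mulVec _ _ ((_ : Matrix _ _ ℝ) *ᵥ _),
    hd, skewTri_mulVec]
  congr 2 <;> ring

theorem skewTriDeriv_sub_transpose (a : Fin (2 * n + 1) → ℝ) (u : Fin (2 * n + 2) → ℝ) :
    skewTriDeriv n a u - (skewTriDeriv n a u)ᵀ
      = skewTri n (a * ((leftEnd n - rightEnd n) *ᵥ u)) := by
  have hd : Matrix.diagonal (a * ((leftEnd n - rightEnd n) *ᵥ u))
      = Matrix.diagonal (a * (leftEnd n *ᵥ u)) - Matrix.diagonal (a * (rightEnd n *ᵥ u)) := by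
    rw [Matrix.sub_mulVec, mul_sub, Matrix.diagonal_sub]
    rfl
  simp only [skewTriDeriv, skewTri, hd, Matrix.transpose_mul, Matrix.transpose_sub,
    Matrix.transpose_transpose, Matrix.diagonal_transpose, Matrix.mul_sub, Matrix.sub_mul,
    Matrix.mul_assoc]
  abel

theorem recA_mul_signMatrix (a : Fin (2 * n + 1) → ℝ) :
    recA n a * signMatrix n = signMatrix n * (recA n a)ᵀ := by
  simp [recA, signMatrix_transpose, skewTri_transpose, mul_assoc]

/-- `w_2` and `w_3` form a bi-Hamiltonian pair. -/
theorem isBiHamiltonian (n : ℕ) :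
    IsBiHamiltonian (signMatrix n) fun q => recA n (G n q) where
  isUnit_det := isUnit_signMatrix_det n
  smooth := (smoothMatrix_recA n).comp (contDiff_G n)
  skew := signMatrix_transpose n
  comm q := recA_mul_signMatrix _
  torsion q u v := by
    -- both sides become local after pushing `w_2` through the differences along the edges
    have hB : ∀ x, (leftEnd n - rightEnd n) *ᵥ (signMatrix n *ᵥ x)
        = (leftEnd n + rightEnd n) *ᵥ x := fun x => by
      rw [Matrix.mulVec_mulVec, diff_mul_signMatrix]
    have hBT : ∀ g, signMatrix n *ᵥ ((leftEnd n - rightEnd n)ᵀ *ᵥ g)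
        = -((leftEnd n + rightEnd n)ᵀ *ᵥ g) := fun g => by
      rw [Matrix.mulVec_mulVec, signMatrix_mul_diff_transpose, Matrix.neg_mulVec]
    simp only [dirDeriv_recA_G, recA_mulVec, Matrix.mulVec_neg, hB, mul_neg, skewTri_neg,
      Matrix.neg_mulVec, neg_neg, neg_sub_neg, ← Matrix.mulVec_sub]
    rw [skewTri_torsion, ← neg_sub (skewTri n _ *ᵥ v), skewTri_closed, Matrix.mulVec_neg, hBT,
      ← neg_sub ((leftEnd n *ᵥ u) * _), mul_neg, Matrix.mulVec_neg]
    simp only [Matrix.mulVec_neg, neg_neg]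
  closed q u := by
    have hK : derivApply (fun y => recA n (G n y)) q u
        = -signMatrix n * skewTriDeriv n (G n q) u := by
      refine matrix_ext_mulVec fun v => ?_
      rw [derivApply_mulVec, dirDeriv_recA_G, ← Matrix.mulVec_mulVec, skewTriDeriv_mulVec,
        Matrix.mulVec_mulVec, recA_eq]
    rw [hK, dirDeriv_recA_G, recA, ← skewTriDeriv_sub_transpose]
    simp only [Matrix.transpose_mul, Matrix.transpose_neg, signMatrix_transpose]
    noncomm_ring

theorem diff_mulVec_X0 (q : Fin (2 * n + 2) → ℝ) :
    (leftEnd n - rightEnd n) *ᵥ X0 n q = 1 := by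
  ext k
  simp [Matrix.sub_mulVec, X0]

theorem X0_eq (q : Fin (2 * n + 2) → ℝ) : X0 n q = X0 n 0 := rfl

theorem isConformal (n : ℕ) : IsConformal (fun q => recA n (G n q)) (X0 n 0) := by
  intro q
  rw [dirDeriv_recA_G, diff_mulVec_X0, mul_one]

theorem leftTerm_eq (q : Fin (2 * n + 2) → ℝ) (i : Fin (2 * n + 2)) :
    leftTerm n q i = ∑ k, G n q k * if i = k.succ then 1 else 0 := by
  refine Fin.cases ?_ (fun k => ?_) i
  · simp [leftTerm, (Fin.succ_ne_zero _).symm]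
  · simp [leftTerm, G]
    rfl

theorem rightTerm_eq (q : Fin (2 * n + 2) → ℝ) (i : Fin (2 * n + 2)) :
    rightTerm n q i = ∑ k, G n q k * if i = k.castSucc then 1 else 0 := by
  refine Fin.lastCases ?_ (fun k => ?_) i
  · simp [rightTerm, (Fin.castSucc_lt_last _).ne']
  · have h : (k : ℕ) + 1 < 2 * n + 2 := by omega
    simp [rightTerm, G, h]
    rfl

theorem w2_eq (q : Fin (2 * n + 2) → ℝ) : w2 n q = signMatrix n := rfl

theorem recA_mul_signMatrix_apply (a : Fin (2 * n + 1) → ℝ) (i j : Fin (2 * n + 2)) :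
    (recA n a * signMatrix n) i j = ∑ k, a k * (signMatrix n i k.succ * signMatrix n k.castSucc j
      - signMatrix n i k.castSucc * signMatrix n k.succ j) := by
  have h : recA n a * signMatrix n
      = (signMatrix n * (rightEnd n)ᵀ) * Matrix.diagonal a * (leftEnd n * signMatrix n)
        - (signMatrix n * (leftEnd n)ᵀ) * Matrix.diagonal a * (rightEnd n * signMatrix n) := by
    simp only [recA, skewTri, Matrix.mul_sub, Matrix.neg_mul, Matrix.sub_mul, Matrix.mul_assoc]
    abel
  rw [h, Matrix.sub_apply, Matrix.mul_apply, Matrix.mul_apply, ← Finset.sum_sub_distrib]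
  simp only [Matrix.mul_diagonal, mul_rightEnd_transpose_apply, mul_leftEnd_transpose_apply,
    rightEnd_mul_apply, leftEnd_mul_apply]
  exact Finset.sum_congr rfl fun k _ => by ring

theorem signMatrix_cases (i j : Fin (2 * n + 2)) :
    ((i : ℕ) < j ∧ signMatrix n i j = 1) ∨ ((j : ℕ) < i ∧ signMatrix n i j = -1) ∨
      ((i : ℕ) = j ∧ signMatrix n i j = 0) := by
  simp only [signMatrix, Matrix.of_apply, Fin.lt_def]
  split_ifs <;> first | omega | simp_all <;> omega

theorem w3Entry_eq (q : Fin (2 * n + 2) → ℝ) {i j : Fin (2 * n + 2)} (hij : i < j) :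
    w3Entry n q i j = (recA n (G n q) * signMatrix n) i j := by
  have hr : (if (i : ℕ) + 1 = j then 0 else rightTerm n q i)
      = ∑ k, G n q k * if i = k.castSucc ∧ ¬ (i : ℕ) + 1 = j then 1 else 0 := by
    split_ifs with h
    · simp [h]
    · simp [h, rightTerm_eq]
  rw [recA_mul_signMatrix_apply, w3Entry, hr, leftTerm_eq, leftTerm_eq, rightTerm_eq]
  simp only [← Finset.sum_add_distrib]
  refine Finset.sum_congr rfl fun k _ => ?_
  rw [← mul_add, ← mul_add, ← mul_add]
  congr 1
  have hij' : (i : ℕ) < j := hij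
  have hi := signMatrix_cases i k.castSucc
  have hi' := signMatrix_cases i k.succ
  have hj := signMatrix_cases k.castSucc j
  have hj' := signMatrix_cases k.succ j
  simp only [Fin.ext_iff, Fin.val_castSucc, Fin.val_succ] at hi hi' hj hj' ⊢
  -- the contributions of the edges not touching `i` or `j` cancel
  rcases hi with ⟨h1, hi⟩ | ⟨h1, hi⟩ | ⟨h1, hi⟩ <;>
  rcases hi' with ⟨h2, hi'⟩ | ⟨h2, hi'⟩ | ⟨h2, hi'⟩ <;> try omega
  all_goals
    rcases hj with ⟨h3, hj⟩ | ⟨h3, hj⟩ | ⟨h3, hj⟩ <;> try omega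
  all_goals
    rcases hj' with ⟨h4, hj'⟩ | ⟨h4, hj'⟩ | ⟨h4, hj'⟩ <;> try omega
  all_goals
    rw [hi, hi', hj, hj']
    split_ifs <;> first | omega | norm_num

theorem w3_eq (q : Fin (2 * n + 2) → ℝ) : w3 n q = recA n (G n q) * signMatrix n := by
  have hs : (recA n (G n q) * signMatrix n)ᵀ = -(recA n (G n q) * signMatrix n) := by
    simpa using transpose_pow_mul (signMatrix_transpose n) (recA_mul_signMatrix (G n q)) 1
  ext i j
  have hs' := congrFun (congrFun hs i) j
  rw [Matrix.transpose_apply, Matrix.neg_apply] at hs'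
  rw [w3, Matrix.of_apply]
  split_ifs with h1 h2
  · exact w3Entry_eq q h1
  · rw [w3Entry_eq q h2]
    linarith
  · obtain rfl : i = j := le_antisymm (not_lt.1 h2) (not_lt.1 h1)
    linarith

theorem recursion_eq (q : Fin (2 * n + 2) → ℝ) : recursion n q = recA n (G n q) := by
  rw [recursion, w3_eq, w2_eq, Matrix.mul_nonsing_inv_cancel_right _ _ (isUnit_signMatrix_det n)]

theorem w_eq (j : ℕ) : w n j = fun q => recA n (G n q) ^ (j - 2) * signMatrix n := by
  funext q
  rw [w, recursion_eq, w2_eq]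

theorem X_eq (k : ℕ) : X n k = fun q => recA n (G n q) ^ k *ᵥ X0 n 0 := by
  funext q
  rw [X, recursion_eq, X0_eq q]

end RecursionOperator

/-! ### The Lax matrix and the Lenard recursion -/

section TracePowers

variable {ι κ : Type*} [Fintype ι] [DecidableEq ι] [Fintype κ] [DecidableEq κ]
  {M : (ι → ℝ) → Matrix κ κ ℝ}

theorem trace_pow_mul_dirDeriv_pow (hM : SmoothMatrix M) (s m : ℕ) (x v : ι → ℝ) :
    (M x ^ s * dirDeriv (fun y => M y ^ (m + 1)) x v).trace
      = ((m : ℝ) + 1) * (M x ^ (s + m) * dirDeriv M x v).trace := by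
  induction m generalizing s with
  | zero => simp
  | succ m ih =>
    have h : (fun y => M y ^ (m + 1 + 1)) = fun y => M y * M y ^ (m + 1) := by
      funext y; rw [pow_succ']
    rw [h, dirDeriv_mul hM (hM.pow _), mul_add, Matrix.trace_add, ← mul_assoc _ (M x), ← pow_succ,
      ih, ← mul_assoc, Matrix.trace_mul_cycle, ← pow_add, show m + 1 + s = s + (m + 1) by ring,
      show s + 1 + m = s + (m + 1) by ring]
    push_cast
    ring

theorem fderiv_trace (hM : SmoothMatrix M) (x v : ι → ℝ) :
    fderiv ℝ (fun y => (M y).trace) x v = (dirDeriv M x v).trace := by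
  simp only [Matrix.trace, Matrix.diag]
  rw [fderiv_fun_sum fun i _ => hM.differentiableAt i i x, _root_.sum_apply]
  rfl

theorem contDiff_trace (hM : SmoothMatrix M) : ContDiff ℝ ∞ fun y => (M y).trace :=
  ContDiff.sum fun i _ => hM i i

end TracePowers

section Lax

variable {n : ℕ}

/-- The constant superdiagonal part of the Lax matrix. -/
def shift (n : ℕ) : Matrix (Fin (2 * n + 2)) (Fin (2 * n + 2)) ℝ :=
  (leftEnd n)ᵀ * rightEnd n

/-- The subdiagonal part of the Lax matrix. -/
def lowerPart (n : ℕ) (a : Fin (2 * n + 1) → ℝ) : Matrix (Fin (2 * n + 2)) (Fin (2 * n + 2)) ℝ :=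
  (rightEnd n)ᵀ * Matrix.diagonal a * leftEnd n

theorem lowerPart_apply (a : Fin (2 * n + 1) → ℝ) (i j : Fin (2 * n + 2)) :
    lowerPart n a i j = ∑ k, a k * (rightEnd n k i * leftEnd n k j) := by
  rw [lowerPart, Matrix.mul_apply]
  simp only [Matrix.mul_diagonal, Matrix.transpose_apply]
  exact Finset.sum_congr rfl fun k _ => by ring

theorem lowerPart_apply_eq (a : Fin (2 * n + 1) → ℝ) (i j : Fin (2 * n + 2)) :
    lowerPart n a i j = if (j : ℕ) + 1 = i then zeroExt a (j : ℕ) else 0 := by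
  rw [lowerPart_apply]
  refine Fin.lastCases ?_ (fun k => ?_) j
  · rw [if_neg (by simp; omega)]
    simp [leftEnd, (Fin.castSucc_lt_last _).ne']
  · rw [Finset.sum_eq_single k (fun b _ hb => by simp [leftEnd, hb.symm])
        (fun h => absurd (Finset.mem_univ k) h)]
    simp [leftEnd, rightEnd, Fin.ext_iff, eq_comm]

theorem lax_eq (a : Fin (2 * n + 1) → ℝ) : lax n a = shift n + lowerPart n a := by
  have hS : shift n = (lowerPart n 1)ᵀ := by
    simp [shift, lowerPart, Matrix.transpose_mul]
  ext i j
  rw [Matrix.add_apply, hS, Matrix.transpose_apply, lowerPart_apply_eq, lowerPart_apply_eq, lax,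
    Matrix.of_apply]
  by_cases h1 : (i : ℕ) + 1 = j
  · rw [if_pos h1, if_pos h1, if_neg (by omega), add_zero]
    exact (zeroExt_coe (1 : Fin (2 * n + 1) → ℝ) ⟨i, by omega⟩).symm
  · rw [if_neg h1, if_neg h1, zero_add]
    split_ifs with h2
    · exact (zeroExt_coe a ⟨j, by omega⟩).symm
    · rfl

theorem smoothMatrix_lowerPart (n : ℕ) : SmoothMatrix (lowerPart n) := by
  intro i j
  simp only [lowerPart_apply]
  exact contDiff_linear_sum _

theorem smoothMatrix_lax (n : ℕ) : SmoothMatrix (lax n) := by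
  intro i j
  simp only [lax_eq, Matrix.add_apply]
  exact contDiff_const.add (smoothMatrix_lowerPart n i j)

theorem dirDeriv_lax (a v : Fin (2 * n + 1) → ℝ) : dirDeriv (lax n) a v = lowerPart n v := by
  ext i j
  simp only [dirDeriv, lax_eq, Matrix.of_apply, Matrix.add_apply, fderiv_const_add]
  simp only [lowerPart_apply]
  exact fderiv_linear_sum _ a v

theorem contDiff_I (n l : ℕ) : ContDiff ℝ ∞ (I n l) :=
  (contDiff_trace ((smoothMatrix_lax n).pow (2 * l))).div_const _

theorem differential_I {l : ℕ} (hl : 1 ≤ l) (a : Fin (2 * n + 1) → ℝ) (k : Fin (2 * n + 1)) :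
    differential (I n l) a k = (lax n a ^ (2 * l - 1)) k.castSucc k.succ := by
  obtain ⟨m, rfl⟩ : ∃ m, l = m + 1 := ⟨l - 1, by omega⟩
  have hL := smoothMatrix_lax n
  have h1 := trace_pow_mul_dirDeriv_pow hL 0 (2 * m + 1) a (Pi.single k 1)
  rw [pow_zero, one_mul, zero_add, dirDeriv_lax, lowerPart, ← Matrix.mul_assoc,
    ← Matrix.mul_assoc, Matrix.trace_mul_comm, ← Matrix.mul_assoc, ← Matrix.mul_assoc,
    Matrix.diagonal_single] at h1
  have hd : Differentiable ℝ fun y => (lax n y ^ (2 * (m + 1))).trace :=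
    (contDiff_trace (hL.pow _)).differentiable (by simp)
  have h2 : differential (I n (m + 1)) a k
      = (dirDeriv (fun y => lax n y ^ (2 * (m + 1))) a (Pi.single k 1)).trace
        / (2 * (m + 1 : ℕ) : ℝ) := by
    rw [← fderiv_trace (hL.pow _)]
    have hI : I n (m + 1)
        = fun y => (lax n y ^ (2 * (m + 1))).trace * (2 * ((m + 1 : ℕ) : ℝ))⁻¹ := by
      funext y
      rw [I, div_eq_mul_inv]
    rw [differential, partialD, hI, fderiv_mul_const (hd a), div_eq_mul_inv]
    exact mul_comm _ _
  rw [h2, show 2 * (m + 1) = 2 * m + 1 + 1 by ring, h1]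
  have h3 : (2 * ((m + 1 : ℕ) : ℝ)) ≠ 0 := by positivity
  rw [div_eq_iff h3, Matrix.trace_mul_single, mul_rightEnd_transpose_apply, leftEnd_mul_apply,
    Nat.add_sub_cancel, MulOpposite.op_one, one_smul]
  push_cast
  ring

theorem diag_leftEnd_transpose_mul (Y : Matrix (Fin (2 * n + 1)) (Fin (2 * n + 2)) ℝ) :
    ((leftEnd n)ᵀ * Y).diag = (leftEnd n)ᵀ *ᵥ fun k => Y k k.castSucc := by
  ext i
  simp only [Matrix.diag, Matrix.mul_apply, Matrix.mulVec, dotProduct]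
  refine Finset.sum_congr rfl fun k _ => ?_
  by_cases h : i = k.castSucc <;> simp [leftEnd, h]

theorem diag_rightEnd_transpose_mul (Y : Matrix (Fin (2 * n + 1)) (Fin (2 * n + 2)) ℝ) :
    ((rightEnd n)ᵀ * Y).diag = (rightEnd n)ᵀ *ᵥ fun k => Y k k.succ := by
  ext i
  simp only [Matrix.diag, Matrix.mul_apply, Matrix.mulVec, dotProduct]
  refine Finset.sum_congr rfl fun k _ => ?_
  by_cases h : i = k.succ <;> simp [rightEnd, h]

theorem diag_mul_leftEnd (Y : Matrix (Fin (2 * n + 2)) (Fin (2 * n + 1)) ℝ) :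
    (Y * leftEnd n).diag = (leftEnd n)ᵀ *ᵥ fun k => Y k.castSucc k := by
  rw [← Matrix.diag_transpose, Matrix.transpose_mul, diag_leftEnd_transpose_mul]
  rfl

theorem diag_mul_rightEnd (Y : Matrix (Fin (2 * n + 2)) (Fin (2 * n + 1)) ℝ) :
    (Y * rightEnd n).diag = (rightEnd n)ᵀ *ᵥ fun k => Y k.succ k := by
  rw [← Matrix.diag_transpose, Matrix.transpose_mul, diag_rightEnd_transpose_mul]
  rfl

theorem diag_shift_mul (Z : Matrix (Fin (2 * n + 2)) (Fin (2 * n + 2)) ℝ) :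
    (shift n * Z).diag = (leftEnd n)ᵀ *ᵥ fun k => Z k.succ k.castSucc := by
  rw [shift, Matrix.mul_assoc, diag_leftEnd_transpose_mul]
  simp

theorem diag_mul_shift (Z : Matrix (Fin (2 * n + 2)) (Fin (2 * n + 2)) ℝ) :
    (Z * shift n).diag = (rightEnd n)ᵀ *ᵥ fun k => Z k.succ k.castSucc := by
  rw [shift, ← Matrix.mul_assoc, diag_mul_rightEnd]
  simp

theorem diag_lowerPart_mul (a : Fin (2 * n + 1) → ℝ)
    (Z : Matrix (Fin (2 * n + 2)) (Fin (2 * n + 2)) ℝ) :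
    (lowerPart n a * Z).diag = (rightEnd n)ᵀ *ᵥ fun k => a k * Z k.castSucc k.succ := by
  rw [lowerPart, Matrix.mul_assoc, Matrix.mul_assoc, diag_rightEnd_transpose_mul]
  simp [Matrix.diagonal_mul]

theorem diag_mul_lowerPart (a : Fin (2 * n + 1) → ℝ)
    (Z : Matrix (Fin (2 * n + 2)) (Fin (2 * n + 2)) ℝ) :
    (Z * lowerPart n a).diag = (leftEnd n)ᵀ *ᵥ fun k => a k * Z k.castSucc k.succ := by
  rw [lowerPart, ← Matrix.mul_assoc, ← Matrix.mul_assoc, diag_mul_leftEnd]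
  simp [Matrix.mul_diagonal, mul_comm]

theorem mul_lowerPart_apply (a : Fin (2 * n + 1) → ℝ)
    (Z : Matrix (Fin (2 * n + 2)) (Fin (2 * n + 2)) ℝ) (i : Fin (2 * n + 2))
    (k : Fin (2 * n + 1)) : (Z * lowerPart n a) i k.castSucc = a k * Z i k.succ := by
  rw [lowerPart, ← Matrix.mul_assoc, ← Matrix.mul_assoc, Matrix.mul_apply]
  simp [Matrix.mul_diagonal, mul_comm, leftEnd]

theorem lowerPart_mul_apply (a : Fin (2 * n + 1) → ℝ)
    (Z : Matrix (Fin (2 * n + 2)) (Fin (2 * n + 2)) ℝ) (j : Fin (2 * n + 2))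
    (k : Fin (2 * n + 1)) : (lowerPart n a * Z) k.succ j = a k * Z k.castSucc j := by
  rw [lowerPart, Matrix.mul_assoc, Matrix.mul_assoc, Matrix.mul_apply]
  simp [Matrix.diagonal_mul, rightEnd]

/-- A vector on the edges is determined by its divergence on the nodes. -/
theorem diff_transpose_injective {f g : Fin (2 * n + 1) → ℝ}
    (h : (leftEnd n - rightEnd n)ᵀ *ᵥ f = (leftEnd n - rightEnd n)ᵀ *ᵥ g) : f = g := by
  have h' : ∀ i : ℤ, zeroExt f i - zeroExt f (i - 1) = zeroExt g i - zeroExt g (i - 1) := fun i => by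
    simpa only [Matrix.transpose_sub, Matrix.sub_mulVec, zeroExt_sub, zeroExt_leftEnd_transpose,
      zeroExt_rightEnd_transpose] using congrArg (zeroExt · i) h
  have key : ∀ k : ℕ, zeroExt f ((k : ℤ) - 1) = zeroExt g ((k : ℤ) - 1) := by
    intro k
    induction k with
    | zero => rw [zeroExt_of_not_mem _ (by simp), zeroExt_of_not_mem _ (by simp)]
    | succ k ih =>
      have := h' k
      push_cast
      rw [add_sub_cancel_right]
      linarith
  ext k
  simpa using key (k + 1)

/-- A matrix commuting with the Lax matrix has the symmetry of the powers of the Lax matrix, which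
is conjugate to a symmetric matrix by a diagonal one. -/
theorem subdiag_eq_mul_superdiag {a : Fin (2 * n + 1) → ℝ}
    {M : Matrix (Fin (2 * n + 2)) (Fin (2 * n + 2)) ℝ} (h : lax n a * M = M * lax n a) :
    (fun k : Fin (2 * n + 1) => M k.succ k.castSucc)
      = fun k => a k * M k.castSucc k.succ := by
  apply diff_transpose_injective
  have h1 := congrArg Matrix.diag h
  rw [lax_eq, add_mul, mul_add, Matrix.diag_add, Matrix.diag_add, diag_shift_mul, diag_mul_shift,
    diag_lowerPart_mul, diag_mul_lowerPart] at h1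
  rw [Matrix.transpose_sub, Matrix.sub_mulVec, Matrix.sub_mulVec, sub_eq_sub_iff_add_eq_add, h1]
  exact add_comm _ _

/-- The logarithmic gradient `a_k ∂I_l/∂a_k` of the integrals. -/
def logGrad (n l : ℕ) (a : Fin (2 * n + 1) → ℝ) : Fin (2 * n + 1) → ℝ :=
  fun k => a k * (lax n a ^ (2 * l - 1)) k.castSucc k.succ

/-- The diagonal of an even power of the Lax matrix, in terms of the gradient of the integrals. -/
theorem diag_lax_pow {l : ℕ} (hl : 1 ≤ l) (a : Fin (2 * n + 1) → ℝ) :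
    (lax n a ^ (2 * l)).diag = (leftEnd n + rightEnd n)ᵀ *ᵥ logGrad n l a := by
  have hc : lax n a * lax n a ^ (2 * l - 1) = lax n a ^ (2 * l - 1) * lax n a :=
    (Commute.self_pow _ _)
  have h := subdiag_eq_mul_superdiag hc
  rw [show 2 * l = 2 * l - 1 + 1 by omega, pow_succ', lax_eq, add_mul, Matrix.diag_add,
    diag_shift_mul, diag_lowerPart_mul, ← lax_eq, h, Matrix.transpose_add, Matrix.add_mulVec]
  rfl

/-- The Lenard recursion on the level of logarithmic gradients; both sides are the diagonal of the
commutator of the shift with `L^(2l+1)`. -/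
theorem lenard {l : ℕ} (a : Fin (2 * n + 1) → ℝ) :
    (leftEnd n - rightEnd n)ᵀ *ᵥ logGrad n (l + 1) a
      = skewTri n a *ᵥ (lax n a ^ (2 * l)).diag := by
  set P := lax n a ^ (2 * l) with hP
  have hpow : lax n a ^ (2 * (l + 1) - 1) = P * lax n a := by
    rw [hP, ← pow_succ]; congr 1
  have hc : lax n a * P = P * lax n a := Commute.self_pow _ _
  have hs := subdiag_eq_mul_superdiag (a := a) (M := P * lax n a) (by rw [← mul_assoc, hc])
  -- writing the second term as `L P S`, the parts `S P S` with two shifts cancel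
  have hcomm : shift n * (P * lax n a) - P * lax n a * shift n
      = shift n * (P * lowerPart n a) - (lowerPart n a * P) * shift n := by
    rw [show P * lax n a * shift n = lax n a * P * shift n by rw [hc], lax_eq]
    noncomm_ring
  have hd := congrArg Matrix.diag hcomm
  rw [Matrix.diag_sub, Matrix.diag_sub, diag_shift_mul, diag_shift_mul, diag_mul_shift,
    diag_mul_shift, hs] at hd
  simp only [mul_lowerPart_apply, lowerPart_mul_apply] at hd
  rw [skewTri_mulVec, Matrix.transpose_sub, Matrix.sub_mulVec]
  unfold logGrad
  rw [hpow, hd]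
  congr 2 <;> (ext k; simp)

theorem trace_lax_pow {l : ℕ} (hl : 1 ≤ l) (a : Fin (2 * n + 1) → ℝ) :
    (lax n a ^ (2 * l)).trace = 2 * ∑ k, logGrad n l a k := by
  have h1 : (leftEnd n + rightEnd n) *ᵥ (1 : Fin (2 * n + 2) → ℝ) = 2 := by
    ext k
    simp [Matrix.add_mulVec]
    norm_num
  have h2 : (lax n a ^ (2 * l)).trace = (lax n a ^ (2 * l)).diag ⬝ᵥ 1 := by
    simp [Matrix.trace, dotProduct]
  rw [h2, diag_lax_pow hl, Matrix.mulVec_transpose, ← Matrix.dotProduct_mulVec, h1]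
  simp [dotProduct, ← Finset.sum_mul, mul_comm]

theorem lax_castSucc_succ (a : Fin (2 * n + 1) → ℝ) (k : Fin (2 * n + 1)) :
    lax n a k.castSucc k.succ = 1 := by
  simp [lax]

theorem logGrad_one (a : Fin (2 * n + 1) → ℝ) : logGrad n 1 a = a := by
  ext k
  simp [logGrad, lax_castSucc_succ]

theorem I_one (a : Fin (2 * n + 1) → ℝ) : I n 1 a = ∑ k, a k := by
  have h := trace_lax_pow le_rfl a
  rw [logGrad_one] at h
  simp [I, h]

theorem sum_logGrad {l : ℕ} (hl : 1 ≤ l) (a : Fin (2 * n + 1) → ℝ) :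
    ∑ k, logGrad n l a k = l * I n l a := by
  have : (l : ℝ) ≠ 0 := by positivity
  rw [I, trace_lax_pow hl]
  field_simp

/-- The Lax matrix has nonnegative entries, and `L ^ 2` has a positive first diagonal entry. -/
theorem I_pos {l : ℕ} (hl : 1 ≤ l) {a : Fin (2 * n + 1) → ℝ} (ha : ∀ k, 0 < a k) :
    0 < I n l a := by
  have h0 : ∀ i j, 0 ≤ lax n a i j := by
    intro i j
    rw [lax, Matrix.of_apply]
    split_ifs
    exacts [zero_le_one, (ha _).le, le_rfl]
  have hnn : ∀ m i j, 0 ≤ (lax n a ^ m) i j := by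
    intro m
    induction m with
    | zero => intro i j; rw [pow_zero, Matrix.one_apply]; split_ifs <;> norm_num
    | succ m ih =>
      intro i j
      rw [pow_succ, Matrix.mul_apply]
      exact Finset.sum_nonneg fun k _ => mul_nonneg (ih i k) (h0 k j)
  have hle : ∀ (M M' : Matrix (Fin (2 * n + 2)) (Fin (2 * n + 2)) ℝ), (∀ i j, 0 ≤ M i j) →
      (∀ i j, 0 ≤ M' i j) → ∀ i k j, M i k * M' k j ≤ (M * M') i j := by
    intro M M' hM hM' i k j
    rw [Matrix.mul_apply]
    exact Finset.single_le_sum (f := fun k => M i k * M' k j)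
      (fun k _ => mul_nonneg (hM i k) (hM' k j)) (Finset.mem_univ k)
  have h2 : 0 < (lax n a ^ 2) 0 0 := by
    refine lt_of_lt_of_le ?_ ((pow_two (lax n a)).symm ▸ hle _ _ h0 h0 0 1 0)
    have : lax n a 0 1 = 1 := by simp [lax]
    have h10 : lax n a 1 0 = a 0 := by simp [lax]
    rw [this, h10, one_mul]
    exact ha 0
  have hpos : ∀ m, 0 < (lax n a ^ (2 * m)) 0 0 := by
    intro m
    induction m with
    | zero => simp
    | succ m ih =>
      rw [mul_add, mul_one, pow_add]
      exact (mul_pos ih h2).trans_le (hle _ _ (hnn _) (hnn _) 0 0 0)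
  rw [I]
  refine div_pos ?_ (by positivity)
  exact Finset.sum_pos' (fun i _ => hnn _ i i) ⟨0, Finset.mem_univ _, hpos l⟩

end Lax

section Hamiltonians

variable {n : ℕ}

theorem contDiff_I_G (n l : ℕ) : ContDiff ℝ ∞ fun q => I n l (G n q) :=
  (contDiff_I n l).comp (contDiff_G n)

theorem differential_I_G {l : ℕ} (hl : 1 ≤ l) (q : Fin (2 * n + 2) → ℝ) :
    differential (fun y => I n l (G n y)) q
      = (leftEnd n - rightEnd n)ᵀ *ᵥ logGrad n l (G n q) := by
  rw [differential_comp (contDiff_I n l) (contDiff_G n), jacobian_G, Matrix.transpose_mul,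
    ← Matrix.mulVec_mulVec]
  congr 1
  ext k
  simp [Matrix.mulVec_diagonal, differential_I hl, logGrad]

theorem hamField_I_G_succ {l : ℕ} (hl : 1 ≤ l) (q : Fin (2 * n + 2) → ℝ) :
    hamField (w2 n) (fun y => I n (l + 1) (G n y)) q
      = recA n (G n q) *ᵥ hamField (w2 n) (fun y => I n l (G n y)) q := by
  rw [hamField, hamField, w2_eq, differential_I_G hl, differential_I_G (by omega), lenard,
    diag_lax_pow hl, Matrix.mulVec_mulVec _ (signMatrix n) (leftEnd n - rightEnd n)ᵀ,
    signMatrix_mul_diff_transpose, recA_mulVec, Matrix.neg_mulVec, Matrix.mulVec_neg,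
    Matrix.mulVec_neg, neg_neg]

theorem i1_eq (n : ℕ) : i1 n = fun q => I n 1 (G n q) := by
  funext q
  rw [I_one]
  rfl

/-- The flows of the hierarchy are Hamiltonian for `w_2`, with Hamiltonians `i_j = I_j ∘ G`. -/
theorem chi_eq {j : ℕ} (hj : 1 ≤ j) (q : Fin (2 * n + 2) → ℝ) :
    chi n j q = hamField (w2 n) (fun y => I n j (G n y)) q := by
  obtain ⟨m, rfl⟩ : ∃ m, j = m + 1 := ⟨j - 1, by omega⟩
  rw [chi, recursion_eq, i1_eq, Nat.add_sub_cancel]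
  induction m with
  | zero => simp
  | succ m ih =>
    rw [hamField_I_G_succ (l := m + 1) (by omega), ← ih (by omega), Matrix.mulVec_mulVec, ← pow_succ']

/-- Euler's identity: the logarithmic derivative along `X_0` is `1` in each `a_k`. -/
theorem lieFun_X0_I_G {l : ℕ} (hl : 1 ≤ l) (q : Fin (2 * n + 2) → ℝ) :
    lieFun (X0 n) (fun y => I n l (G n y)) q = l * I n l (G n q) := by
  rw [lieFun, fderiv_eq_dotProduct, differential_I_G hl, Matrix.mulVec_transpose,
    ← Matrix.dotProduct_mulVec, diff_mulVec_X0, ← sum_logGrad hl]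
  simp [dotProduct]

/-- The Lenard recursion for differentials: `d i_{k+l} = (Rᵀ)^k d i_l`. -/
theorem differential_I_G_add {l : ℕ} (hl : 1 ≤ l) (k : ℕ) (q : Fin (2 * n + 2) → ℝ) :
    differential (fun y => I n (k + l) (G n y)) q
      = (recA n (G n q))ᵀ ^ k *ᵥ differential (fun y => I n l (G n y)) q := by
  induction k with
  | zero => simp
  | succ k ih =>
    have hinj : Function.Injective (signMatrix n).mulVec :=
      Matrix.mulVec_injective_iff_isUnit.2
        ((Matrix.isUnit_iff_isUnit_det _).2 (isUnit_signMatrix_det n))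
    apply hinj
    have h := hamField_I_G_succ (n := n) (l := k + l) (by omega) q
    rw [hamField, hamField, w2_eq, ih] at h
    rw [show k + 1 + l = k + l + 1 by ring, h, Matrix.mulVec_mulVec, Matrix.mulVec_mulVec,
      Matrix.mulVec_mulVec, recA_mul_signMatrix, mul_assoc, ← pow_succ']

theorem lieFun_X_I_G {l : ℕ} (hl : 1 ≤ l) (k : ℕ) (q : Fin (2 * n + 2) → ℝ) :
    lieFun (X n k) (fun y => I n l (G n y)) q = ((k : ℝ) + l) * I n (k + l) (G n q) := by
  have h := lieFun_X0_I_G (n := n) (l := k + l) (by omega) q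
  rw [lieFun, fderiv_eq_dotProduct, differential_I_G_add hl, ← Matrix.transpose_pow,
    Matrix.mulVec_transpose, ← Matrix.dotProduct_mulVec] at h
  rw [lieFun, fderiv_eq_dotProduct, X_eq, ← X0_eq q, h]
  push_cast
  ring

end Hamiltonians

/-! ### The KM tensors and the reduction of the Toda tensors -/

section Projection

variable {n : ℕ}

/-- The Jacobian matrix of `G`, as a function of `a = G(q)`. -/
def jacG (n : ℕ) (a : Fin (2 * n + 1) → ℝ) : Matrix (Fin (2 * n + 1)) (Fin (2 * n + 2)) ℝ :=
  Matrix.diagonal a * (leftEnd n - rightEnd n)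

/-- The projection `v_j` of `w_j`. -/
def kmTensor (n j : ℕ) (a : Fin (2 * n + 1) → ℝ) :
    Matrix (Fin (2 * n + 1)) (Fin (2 * n + 1)) ℝ :=
  jacG n a * (recA n a ^ (j - 2) * signMatrix n) * (jacG n a)ᵀ

/-- The projection `Y_k` of `X_k`. -/
def kmMaster (n k : ℕ) (a : Fin (2 * n + 1) → ℝ) : Fin (2 * n + 1) → ℝ :=
  jacG n a *ᵥ (recA n a ^ k *ᵥ X0 n 0)

theorem smoothMatrix_diagonal {ι κ : Type*} [Fintype ι] [DecidableEq κ] {f : (ι → ℝ) → κ → ℝ}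
    (hf : ∀ k, ContDiff ℝ ∞ fun x => f x k) : SmoothMatrix fun x => Matrix.diagonal (f x) := by
  intro i j
  by_cases h : i = j
  · subst h
    simpa using hf i
  · simpa [h] using contDiff_const

theorem smoothMatrix_jacG (n : ℕ) : SmoothMatrix (jacG n) :=
  (smoothMatrix_diagonal fun k => contDiff_apply ℝ ℝ k).mul (smoothMatrix_const _)

theorem smoothMatrix_kmTensor (n j : ℕ) : SmoothMatrix (kmTensor n j) :=
  ((smoothMatrix_jacG n).mul (((smoothMatrix_recA n).pow _).mul (smoothMatrix_const _))).mul
    (smoothMatrix_jacG n).transpose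

theorem contDiff_kmMaster (n k : ℕ) : ContDiff ℝ ∞ (kmMaster n k) :=
  (smoothMatrix_jacG n).mulVec (((smoothMatrix_recA n).pow k).mulVec contDiff_const)

theorem mapsTensor_kmTensor (n j : ℕ) : MapsTensor (G n) (w n j) (kmTensor n j) := by
  intro q
  rw [jacobian_G, w_eq]
  rfl

theorem mapsField_kmMaster (n k : ℕ) : MapsField (G n) (X n k) (kmMaster n k) := by
  intro q
  rw [jacobian_G, X_eq]
  rfl

theorem recA_pow_mul_transpose (m : ℕ) (a : Fin (2 * n + 1) → ℝ) :
    (recA n a ^ m * signMatrix n)ᵀ = -(recA n a ^ m * signMatrix n) :=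
  transpose_pow_mul (signMatrix_transpose n) (recA_mul_signMatrix a) m

theorem kmTensor_transpose (n j : ℕ) (a : Fin (2 * n + 1) → ℝ) :
    (kmTensor n j a)ᵀ = -kmTensor n j a := by
  rw [kmTensor, Matrix.transpose_mul, Matrix.transpose_mul, recA_pow_mul_transpose,
    Matrix.transpose_transpose]
  simp [Matrix.mul_assoc]

theorem range_G (n : ℕ) : Set.range (G n) = Va n := by
  ext a
  constructor
  · rintro ⟨q, rfl⟩ k
    exact Real.exp_pos _
  · intro ha
    refine ⟨fun i => -∑ k : Fin (2 * n + 1), if (k : ℕ) < i then Real.log (a k) else 0, ?_⟩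
    ext j
    have h : (-∑ k : Fin (2 * n + 1), if (k : ℕ) < (j.castSucc : ℕ) then Real.log (a k) else 0)
        - (-∑ k : Fin (2 * n + 1), if (k : ℕ) < (j.succ : ℕ) then Real.log (a k) else 0)
        = Real.log (a j) := by
      rw [neg_sub_neg, ← Finset.sum_sub_distrib,
        Finset.sum_eq_single j _ (fun h => absurd (Finset.mem_univ j) h)]
      · simp
      · intro k _ hk
        have hk' : (k : ℕ) ≠ j := fun h => hk (Fin.ext h)
        simp only [Fin.val_castSucc, Fin.val_succ]
        split_ifs <;> first | omega | simp
    rw [G, h, Real.exp_log (ha j)]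

theorem kmTensor_apply (m : ℕ) (a : Fin (2 * n + 1) → ℝ) (i j : Fin (2 * n + 1)) :
    kmTensor n m a i j = a i * a j * (((leftEnd n - rightEnd n)
      * (recA n a ^ (m - 2) * signMatrix n) * (leftEnd n - rightEnd n)ᵀ) i j) := by
  have h : kmTensor n m a = Matrix.diagonal a * ((leftEnd n - rightEnd n)
      * (recA n a ^ (m - 2) * signMatrix n) * (leftEnd n - rightEnd n)ᵀ) * Matrix.diagonal a := by
    simp only [kmTensor, jacG, Matrix.transpose_mul, Matrix.diagonal_transpose, Matrix.mul_assoc]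
  rw [h, Matrix.mul_diagonal, Matrix.diagonal_mul]
  ring

theorem kmTensor_two (a : Fin (2 * n + 1) → ℝ) : kmTensor n 2 a = v2 n a := by
  ext i j
  rw [kmTensor_apply, Nat.sub_self, pow_zero, one_mul, diff_mul_signMatrix, Matrix.transpose_sub,
    Matrix.mul_sub, Matrix.sub_apply, mul_leftEnd_transpose_apply, mul_rightEnd_transpose_apply]
  simp only [leftEnd, rightEnd, v2, v2Entry, Matrix.of_apply, Matrix.add_apply, Fin.ext_iff,
    Fin.val_castSucc, Fin.val_succ]
  split_ifs <;> first | omega | ring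

theorem skewTri_apply_eq (a : Fin (2 * n + 1) → ℝ) (i j : Fin (2 * n + 2)) :
    skewTri n a i j = if (i : ℕ) + 1 = j then zeroExt a (i : ℕ)
      else if (j : ℕ) + 1 = i then -zeroExt a (j : ℕ) else 0 := by
  have h : skewTri n a = (lowerPart n a)ᵀ - lowerPart n a := by
    simp [skewTri, lowerPart, Matrix.transpose_mul, Matrix.mul_assoc]
  rw [h, Matrix.sub_apply, Matrix.transpose_apply, lowerPart_apply_eq, lowerPart_apply_eq]
  split_ifs <;> first | omega | simp

theorem v3Entry_eq (a : Fin (2 * n + 1) → ℝ) (i j : Fin (2 * n + 1)) :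
    v3Entry n a i j = a i * a j * (if (i : ℕ) + 1 = j then zeroExt a (i : ℕ) + zeroExt a (j : ℕ)
      else if (i : ℕ) + 2 = j then zeroExt a ((i + 1 : ℕ) : ℤ) else 0) := by
  rw [v3Entry, zeroExt_coe, zeroExt_coe]
  split_ifs with h1 h2
  · rfl
  · rw [show zeroExt a (((i : ℕ) + 1 : ℕ) : ℤ) = a ⟨i + 1, by omega⟩ from
      zeroExt_coe a ⟨i + 1, by omega⟩]
    ring
  · ring

theorem kmTensor_three (a : Fin (2 * n + 1) → ℝ) : kmTensor n 3 a = v3 n a := by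
  have h : (leftEnd n - rightEnd n) * (recA n a ^ (3 - 2) * signMatrix n)
      * (leftEnd n - rightEnd n)ᵀ
      = (leftEnd n + rightEnd n) * skewTri n a * (leftEnd n + rightEnd n)ᵀ := by
    rw [← diff_mul_signMatrix, Matrix.transpose_mul, signMatrix_transpose, pow_one, recA]
    simp only [Matrix.neg_mul, Matrix.mul_neg, Matrix.mul_assoc]
  ext i j
  rw [kmTensor_apply, h, v3, Matrix.of_apply, v3Entry_eq, v3Entry_eq, mul_comm (a j) (a i),
    ← mul_sub]
  congr 1
  simp only [Matrix.transpose_add, Matrix.mul_add, Matrix.add_mul, Matrix.add_apply,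
    mul_leftEnd_transpose_apply, mul_rightEnd_transpose_apply, leftEnd_mul_apply,
    rightEnd_mul_apply, skewTri_apply_eq, Fin.val_castSucc, Fin.val_succ]
  have hi : ∀ k l : ℕ, k = l → zeroExt a (k : ℤ) = zeroExt a (l : ℤ) := fun k l h => by rw [h]
  rcases (by omega : (i : ℕ) = j ∨ (i : ℕ) + 1 = j ∨ (i : ℕ) + 2 = j ∨ (j : ℕ) + 1 = i ∨
    (j : ℕ) + 2 = i ∨ (i : ℕ) + 2 < j ∨ (j : ℕ) + 2 < i) with h | h | h | h | h | h | h
  all_goals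
    split_ifs <;> first | omega | linarith | linarith [hi _ _ h]

theorem kmField_eq (a : Fin (2 * n + 1) → ℝ) :
    hamField (v2 n) (I n 1) a = kmField n a := by
  have h1 : differential (I n 1) a = 1 := by
    ext k
    rw [differential_I le_rfl]
    simp [lax_castSucc_succ]
  ext i
  rw [hamField, h1]
  simp only [Matrix.mulVec, dotProduct, Pi.one_apply, mul_one, v2, v2Entry, Matrix.of_apply,
    Finset.sum_sub_distrib, kmField, mul_sub]
  congr 1
  · split_ifs with h
    · rw [Finset.sum_eq_single ⟨i + 1, h⟩]
      · simp
      · intro b _ hb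
        exact if_neg fun h' => hb (Fin.ext h'.symm)
      · simp
    · rw [mul_zero]
      exact Finset.sum_eq_zero fun b _ => if_neg (by omega)
  · split_ifs with h
    · rw [Finset.sum_eq_single ⟨i - 1, by omega⟩]
      · rw [if_pos (by simp; omega), mul_comm]
      · intro b _ hb
        exact if_neg fun h' => hb (Fin.ext (by simp; omega))
      · simp
    · rw [mul_zero]
      exact Finset.sum_eq_zero fun b _ => if_neg (by omega)

end Projection

section Toda

variable {n : ℕ}

/-- The Jacobian matrix of the Flaschka map, as a function of `(a, b)`. -/
def jacFlaschka (n : ℕ) (y : Fin (2 * n + 1) ⊕ Fin (2 * n + 2) → ℝ) :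
    Matrix (Fin (2 * n + 1) ⊕ Fin (2 * n + 2)) (Fin (2 * n + 2) ⊕ Fin (2 * n + 2)) ℝ :=
  Matrix.fromBlocks (jacG n fun k => y (Sum.inl k)) 0 0 (-1)

/-- The tensor `J_2` as a function of `(a, b)`. -/
def todaTensor (n : ℕ) (y : Fin (2 * n + 1) ⊕ Fin (2 * n + 2) → ℝ) :
    Matrix (Fin (2 * n + 2) ⊕ Fin (2 * n + 2)) (Fin (2 * n + 2) ⊕ Fin (2 * n + 2)) ℝ :=
  Matrix.fromBlocks (signMatrix n) (Matrix.diagonal fun i => y (Sum.inr i))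
    (-Matrix.diagonal fun i => y (Sum.inr i)) (skewTri n fun k => y (Sum.inl k))

/-- The Toda tensor `π_m` on the space of `(a, b)`. -/
def todaPi (n m : ℕ) (y : Fin (2 * n + 1) ⊕ Fin (2 * n + 2) → ℝ) :
    Matrix (Fin (2 * n + 1) ⊕ Fin (2 * n + 2)) (Fin (2 * n + 1) ⊕ Fin (2 * n + 2)) ℝ :=
  jacFlaschka n y * ((todaTensor n y * (J1 n 0)⁻¹) ^ (m - 1) * J1 n 0) * (jacFlaschka n y)ᵀ

theorem J2_eq (x : Fin (2 * n + 2) ⊕ Fin (2 * n + 2) → ℝ) :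
    J2 n x = todaTensor n (flaschka n x) := by
  have h : (Matrix.of fun i j : Fin (2 * n + 2) =>
      if (i : ℕ) + 1 = j then Real.exp (x (Sum.inl i) - x (Sum.inl j))
      else if (j : ℕ) + 1 = i then -Real.exp (x (Sum.inl j) - x (Sum.inl i)) else 0)
      = skewTri n fun k => flaschka n x (Sum.inl k) := by
    have key : ∀ i j : Fin (2 * n + 2), (i : ℕ) + 1 = j →
        Real.exp (x (Sum.inl i) - x (Sum.inl j))
          = zeroExt (fun k => flaschka n x (Sum.inl k)) (i : ℕ) := by
      intro i j hij
      obtain ⟨k, rfl⟩ : ∃ k : Fin (2 * n + 1), i = k.castSucc :=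
        ⟨⟨i, by omega⟩, rfl⟩
      obtain rfl : j = k.succ := Fin.ext hij.symm
      rw [Fin.val_castSucc, zeroExt_coe]
      rfl
    ext i j
    rw [skewTri_apply_eq, Matrix.of_apply]
    split_ifs with h1 h2
    · exact key i j h1
    · rw [key j i h2]
    · rfl
  rw [J2, todaTensor, h]
  rfl

theorem jacobian_flaschka (x : Fin (2 * n + 2) ⊕ Fin (2 * n + 2) → ℝ) :
    jacobian (flaschka n) x = jacFlaschka n (flaschka n x) := by
  have hl : ∀ k i, jacobian (flaschka n) x (Sum.inl k) i
      = Real.exp (x (Sum.inl k.castSucc) - x (Sum.inl k.succ))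
        * ((Pi.single i (1 : ℝ) : _ → ℝ) (Sum.inl k.castSucc)
          - (Pi.single i (1 : ℝ) : _ → ℝ) (Sum.inl k.succ)) := by
    intro k i
    have h : HasFDerivAt (fun y : Fin (2 * n + 2) ⊕ Fin (2 * n + 2) → ℝ =>
        Real.exp (y (Sum.inl k.castSucc) - y (Sum.inl k.succ))) _ x :=
      ((hasFDerivAt_apply (𝕜 := ℝ) (Sum.inl k.castSucc) x).sub
        (hasFDerivAt_apply (𝕜 := ℝ) (Sum.inl k.succ) x)).exp
    rw [jacobian, Matrix.of_apply, partialD]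
    change fderiv ℝ (fun y : Fin (2 * n + 2) ⊕ Fin (2 * n + 2) → ℝ =>
      Real.exp (y (Sum.inl k.castSucc) - y (Sum.inl k.succ))) x _ = _
    rw [h.fderiv]
    rfl
  have hr : ∀ k i, jacobian (flaschka n) x (Sum.inr k) i
      = -(Pi.single i (1 : ℝ) : _ → ℝ) (Sum.inr k) := by
    intro k i
    have h : HasFDerivAt (fun y : Fin (2 * n + 2) ⊕ Fin (2 * n + 2) → ℝ => -y (Sum.inr k)) _ x :=
      (hasFDerivAt_apply (𝕜 := ℝ) (Sum.inr k) x).neg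
    rw [jacobian, Matrix.of_apply, partialD]
    change fderiv ℝ (fun y : Fin (2 * n + 2) ⊕ Fin (2 * n + 2) → ℝ => -y (Sum.inr k)) x _ = _
    rw [h.fderiv]
    rfl
  ext k i
  rcases k with k | k
  · rw [hl]
    rcases i with i | i <;>
      simp [jacFlaschka, jacG, flaschka, leftEnd, rightEnd, Pi.single_apply, eq_comm]
  · rw [hr]
    rcases i with i | i <;>
      simp [jacFlaschka, Pi.single_apply, Matrix.one_apply, eq_comm]

theorem mapsTensor_todaPi (n m : ℕ) : MapsTensor (flaschka n) (J n m) (todaPi n m) := by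
  intro x
  rw [jacobian_flaschka, J, J2_eq]
  rfl

theorem J1_inv (n : ℕ) : (J1 n 0)⁻¹ = Matrix.fromBlocks 0 (-1) 1 0 := by
  refine Matrix.inv_eq_left_inv ?_
  simp [J1, Matrix.fromBlocks_multiply]

/-- On the fixed point set `b = 0`, the square of the Toda recursion operator is block diagonal
with first block the recursion operator of the KM system. -/
theorem todaPi_todaFixed {j : ℕ} (hj : 2 ≤ j) (a : Fin (2 * n + 1) → ℝ) :
    ∃ Z, todaPi n (2 * j - 2) (todaFixed n a) = Matrix.fromBlocks (kmTensor n j a) 0 0 Z := by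
  have h0 : todaTensor n (todaFixed n a) = Matrix.fromBlocks (signMatrix n) 0 0 (skewTri n a) := by
    simp [todaTensor, todaFixed]
  have hN : todaTensor n (todaFixed n a) * (J1 n 0)⁻¹
      = Matrix.fromBlocks 0 (-signMatrix n) (skewTri n a) 0 := by
    rw [h0, J1_inv, Matrix.fromBlocks_multiply]
    simp
  have hN2 : (todaTensor n (todaFixed n a) * (J1 n 0)⁻¹) ^ 2
      = Matrix.fromBlocks (recA n a) 0 0 (-(skewTri n a * signMatrix n)) := by
    rw [hN, pow_two, Matrix.fromBlocks_multiply]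
    simp [recA]
  have hJ : (J1 n 0)⁻¹ * J1 n 0 = 1 := by
    rw [J1_inv]
    simp [J1, Matrix.fromBlocks_multiply]
  have hpow : (todaTensor n (todaFixed n a) * (J1 n 0)⁻¹) ^ (2 * j - 2 - 1) * J1 n 0
      = ((todaTensor n (todaFixed n a) * (J1 n 0)⁻¹) ^ 2) ^ (j - 2)
        * todaTensor n (todaFixed n a) := by
    rw [show 2 * j - 2 - 1 = 2 * (j - 2) + 1 by omega, pow_succ, pow_mul, mul_assoc, mul_assoc,
      hJ, mul_one]
  rw [todaPi, hpow, hN2, Matrix.fromBlocks_diagonal_pow, h0, Matrix.fromBlocks_multiply,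
    jacFlaschka, Matrix.fromBlocks_transpose, Matrix.fromBlocks_multiply,
    Matrix.fromBlocks_multiply]
  simp only [Matrix.zero_mul, Matrix.mul_zero, add_zero, zero_add, Matrix.transpose_zero]
  exact ⟨_, rfl⟩

theorem isOpen_Tab (n : ℕ) : IsOpen (Tab n) := by
  have : Tab n = ⋂ i, {y | 0 < y (Sum.inl i)} := by
    ext y; simp [Tab]
  rw [this]
  exact isOpen_iInter_of_finite fun i => isOpen_lt continuous_const (continuous_apply _)

/-- The differential of an invariant function at a fixed point has no component along `b`. -/
theorem differential_todaFixed {f : (Fin (2 * n + 1) ⊕ Fin (2 * n + 2) → ℝ) → ℝ}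
    (hf : ContDiffOn ℝ ∞ f (Tab n)) (hinv : ∀ x ∈ Tab n, f (todaInvolution n x) = f x)
    {a : Fin (2 * n + 1) → ℝ} (ha : a ∈ Va n) :
    differential f (todaFixed n a) = Sum.elim (differential (f ∘ todaFixed n) a) 0 := by
  have hmem : todaFixed n a ∈ Tab n := fun i => ha i
  have hnhds := (isOpen_Tab n).mem_nhds hmem
  have hd : DifferentiableAt ℝ f (todaFixed n a) :=
    (hf.contDiffAt hnhds).differentiableAt (by simp)
  have hs : IsLinearMap ℝ (todaFixed n) := by
    constructor <;> intros <;> ext (i | i) <;> simp [todaFixed]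
  have hφ : IsLinearMap ℝ (todaInvolution n) := by
    constructor <;> intros <;> ext (i | i) <;> simp [todaInvolution, add_comm]
  have hs' : HasFDerivAt (todaFixed n) (LinearMap.toContinuousLinearMap (hs.mk' _)) a :=
    (LinearMap.toContinuousLinearMap (hs.mk' _)).hasFDerivAt
  have hφ' : HasFDerivAt (todaInvolution n) (LinearMap.toContinuousLinearMap (hφ.mk' _))
      (todaFixed n a) :=
    (LinearMap.toContinuousLinearMap (hφ.mk' _)).hasFDerivAt
  have hfix : todaInvolution n (todaFixed n a) = todaFixed n a := by
    ext (i | i) <;> simp [todaInvolution, todaFixed]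
  ext (k | k)
  · simp only [differential, partialD, Sum.elim_inl]
    rw [fderiv_comp a hd hs'.differentiableAt, hs'.fderiv]
    change _ = fderiv ℝ f (todaFixed n a) (todaFixed n (Pi.single k 1))
    congr 1
    ext (i | i) <;> simp [todaFixed, Pi.single_apply]
  -- the derivative of `f` is invariant under the involution, which acts by `-1` along `b`
  · have h1 : fderiv ℝ (f ∘ todaInvolution n) (todaFixed n a) = fderiv ℝ f (todaFixed n a) :=
      Filter.EventuallyEq.fderiv_eq (Filter.mem_of_superset hnhds hinv)
    rw [fderiv_comp _ (hfix.symm ▸ hd) hφ'.differentiableAt, hφ'.fderiv, hfix] at h1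
    have h2 := congrArg (· (Pi.single (Sum.inr k) 1)) h1
    have h3 : todaInvolution n (Pi.single (Sum.inr k) 1) = -Pi.single (Sum.inr k) 1 := by
      ext (i | i) <;> simp [todaInvolution, Pi.single_apply]
    change fderiv ℝ f (todaFixed n a) (todaInvolution n (Pi.single (Sum.inr k) 1))
      = fderiv ℝ f (todaFixed n a) (Pi.single (Sum.inr k) 1) at h2
    rw [h3, map_neg, neg_eq_self] at h2
    simpa [differential, partialD] using h2

theorem isInvolutionReduction_kmTensor {j : ℕ} (hj : 2 ≤ j) :
    IsInvolutionReduction (Tab n) (todaInvolution n) (Va n) (todaFixed n) (todaPi n (2 * j - 2))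
      (kmTensor n j) := by
  intro f g hf hg hfi hgi a ha
  obtain ⟨Z, hZ⟩ := todaPi_todaFixed hj a
  simp only [bracket, hamField]
  rw [differential_todaFixed hf hfi ha, differential_todaFixed hg hgi ha, hZ,
    Matrix.fromBlocks_mulVec]
  simp [sumElim_dotProduct_sumElim]

end Toda

/-! ### The hierarchy and its master symmetries -/

section Hierarchy

variable {n : ℕ}

theorem hamField_w (j : ℕ) (f : (Fin (2 * n + 2) → ℝ) → ℝ) :
    hamField (w n j) f
      = fun q => (recA n (G n q) ^ (j - 2) * signMatrix n) *ᵥ differential f q := by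
  rw [w_eq]
  rfl

theorem smoothMatrix_w (n j : ℕ) : SmoothMatrix (w n j) := by
  rw [w_eq]
  exact (isBiHamiltonian n).smooth_tensor _

theorem contDiff_X (n k : ℕ) : ContDiff ℝ ∞ (X n k) := by
  rw [X_eq]
  exact (isBiHamiltonian n).contDiff_pow_mulVec contDiff_const k

theorem lieTensor_hamField_w (j : ℕ) {f : (Fin (2 * n + 2) → ℝ) → ℝ} (hf : ContDiff ℝ ∞ f)
    (q : Fin (2 * n + 2) → ℝ) : lieTensor (hamField (w n j) f) (w n j) q = 0 := by
  rw [hamField_w, w_eq]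
  exact (isBiHamiltonian n).lieTensor_hamiltonian (contDiff_differential hf)
    (jacobian_differential_transpose hf) _ q

/-- The Jacobi identity, as the invariance of `w_j` under its Hamiltonian vector fields. -/
theorem isPoissonOn_w (n j : ℕ) : IsPoissonOn (w n j) Set.univ := by
  refine isPoissonOn_of_lieTensor (smoothMatrix_w n j) (fun q => ?_) fun q _ i =>
    lieTensor_hamField_w j (contDiff_apply_coord i) q
  rw [w_eq]
  exact recA_pow_mul_transpose _ _

theorem isPoissonOn_kmTensor (n j : ℕ) : IsPoissonOn (kmTensor n j) (Va n) := by
  rw [← range_G]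
  exact (mapsTensor_kmTensor n j).isPoissonOn_range (contDiff_G n) (smoothMatrix_w n j)
    (smoothMatrix_kmTensor n j) (kmTensor_transpose n j) fun f hf => lieTensor_hamField_w j hf

theorem lieTensor_X_w (k : ℕ) {j : ℕ} (hj : 2 ≤ j) (q : Fin (2 * n + 2) → ℝ) :
    lieTensor (X n k) (w n j) q = ((j : ℝ) - k - 2) • w n (k + j) q := by
  rw [X_eq, w_eq, (isBiHamiltonian n).lieTensor_master (isConformal n), w_eq, Nat.cast_sub hj,
    Nat.add_sub_assoc hj]
  congr 1
  push_cast
  ring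

theorem lieBracket_X (k j : ℕ) (q : Fin (2 * n + 2) → ℝ) :
    VectorField.lieBracket ℝ (X n k) (X n j) q = ((j : ℝ) - k) • X n (k + j) q := by
  rw [X_eq, X_eq, X_eq, (isBiHamiltonian n).lieBracket_master (isConformal n)]

theorem signMatrix_mulVec_injective (n : ℕ) : Function.Injective (signMatrix n).mulVec :=
  Matrix.mulVec_injective_iff_isUnit.2
    ((Matrix.isUnit_iff_isUnit_det _).2 (isUnit_signMatrix_det n))

theorem contDiff_chi_one (n : ℕ) : ContDiff ℝ ∞ (hamField (w2 n) (i1 n)) := by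
  rw [i1_eq]
  exact (smoothMatrix_const (signMatrix n)).mulVec (contDiff_differential (contDiff_I_G n 1))

theorem chi_succ (m : ℕ) :
    chi n (m + 1) = fun q => recA n (G n q) ^ m *ᵥ hamField (w2 n) (i1 n) q := by
  funext q
  rw [chi, recursion_eq, Nat.add_sub_cancel]

/-- `χ_1` preserves `R`, being Hamiltonian for `w_2` together with `R χ_1 = w_2 di_2`. -/
theorem lieEnd_chi_one (q : Fin (2 * n + 2) → ℝ) :
    lieEnd (hamField (w2 n) (i1 n)) (fun y => recA n (G n y)) q = 0 := by
  have h1 := contDiff_I_G n 1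
  have h2 := contDiff_I_G n 2
  rw [i1_eq]
  exact (isBiHamiltonian n).lieEnd_bihamiltonian (contDiff_differential h1)
    (jacobian_differential_transpose h1) (contDiff_differential h2)
    (jacobian_differential_transpose h2) (fun x => hamField_I_G_succ le_rfl x) q

theorem lieBracket_X0_chi_one (q : Fin (2 * n + 2) → ℝ) :
    VectorField.lieBracket ℝ (fun _ => X0 n 0) (hamField (w2 n) (i1 n)) q
      = hamField (w2 n) (i1 n) q := by
  have h : hamField (w2 n) (i1 n)
      = fun y => (signMatrix n * (leftEnd n - rightEnd n)ᵀ) *ᵥ G n y := by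
    funext y
    rw [hamField, i1_eq, differential_I_G le_rfl, logGrad_one, Matrix.mulVec_mulVec, w2_eq]
  rw [lieBracket_eq contDiff_const (contDiff_chi_one n), jacobian_const, Matrix.zero_mulVec,
    sub_zero, h, jacobian_const_mulVec _ (contDiff_G n), ← Matrix.mulVec_mulVec,
    jacobian_G_mulVec, diff_mulVec_X0, mul_one]

/-- `X_0(i_j) = j i_j` is positive, so `i_j` has no critical points. -/
theorem chi_ne_zero {j : ℕ} (hj : 1 ≤ j) : chi n j 0 ≠ 0 := by
  intro h
  rw [chi_eq hj, hamField, w2_eq] at h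
  have h0 : differential (fun y => I n j (G n y)) 0 = 0 :=
    signMatrix_mulVec_injective n (h.trans (Matrix.mulVec_zero _).symm)
  have h1 := lieFun_X0_I_G (n := n) hj 0
  rw [lieFun, fderiv_eq_dotProduct, h0, zero_dotProduct] at h1
  have h2 : 0 < I n j (G n 0) := I_pos hj fun k => Real.exp_pos _
  have h3 : (0 : ℝ) < j := by exact_mod_cast hj
  exact (mul_pos h3 h2).ne h1

theorem contDiff_chi_succ (n m : ℕ) : ContDiff ℝ ∞ (chi n (m + 1)) := by
  rw [chi_succ]
  exact (isBiHamiltonian n).contDiff_pow_mulVec (contDiff_chi_one n) m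

theorem lieBracket_X_chi (k : ℕ) {j : ℕ} (hj : 1 ≤ j) :
    VectorField.lieBracket ℝ (X n k) (chi n j) = (j : ℝ) • chi n (k + j) := by
  obtain ⟨m, rfl⟩ : ∃ m, j = m + 1 := ⟨j - 1, by omega⟩
  funext q
  rw [X_eq, chi_succ, (isBiHamiltonian n).lieBracket_master_flow (isConformal n)
    (contDiff_chi_one n) lieEnd_chi_one lieBracket_X0_chi_one, ← add_assoc, chi_succ]
  simp

theorem isMasterSymmetry_X (k : ℕ) {j : ℕ} (hj : 1 ≤ j) :
    IsMasterSymmetry (X n k) (chi n j) := by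
  rw [IsMasterSymmetry, lieBracket_X_chi k hj]
  constructor
  · obtain ⟨m, rfl⟩ : ∃ m, j = m + 1 := ⟨j - 1, by omega⟩
    funext q
    rw [← add_assoc, VectorField.lieBracket_const_smul_left
      ((contDiff_chi_succ n _).differentiable (by simp) q), chi_succ, chi_succ,
      (isBiHamiltonian n).lieBracket_flows (contDiff_chi_one n) lieEnd_chi_one, smul_zero,
      Pi.zero_apply]
  · intro h
    have h1 := congrFun h 0
    have h2 : (j : ℝ) ≠ 0 := by positivity
    exact chi_ne_zero (by omega) ((smul_eq_zero.1 h1).resolve_left h2)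

theorem hamField_unique {j : ℕ} (hj : 1 ≤ j) {f : (Fin (2 * n + 2) → ℝ) → ℝ}
    (hf : Differentiable ℝ f) (h : ∀ q, hamField (w2 n) f q = chi n j q) :
    ∃ c : ℝ, ∀ q, f q = I n j (G n q) + c := by
  have hI : Differentiable ℝ fun q => I n j (G n q) := (contDiff_I_G n j).differentiable (by simp)
  refine ⟨f 0 - I n j (G n 0), fun q => ?_⟩
  have hd : ∀ q, fderiv ℝ (fun q => f q - I n j (G n q)) q = 0 := by
    intro q
    have h1 := h q
    rw [chi_eq hj] at h1
    have h2 := signMatrix_mulVec_injective n h1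
    ext v
    rw [fderiv_fun_sub (hf q) (hI q), _root_.sub_apply, fderiv_eq_dotProduct,
      fderiv_eq_dotProduct, h2, sub_self]
    rfl
  have := is_const_of_fderiv_eq_zero (hf.fun_sub hI) hd q 0
  linarith

theorem hamField_w_succ {j l : ℕ} (hj : 3 ≤ j) (hl : 1 ≤ l) (q : Fin (2 * n + 2) → ℝ) :
    hamField (w n j) (fun y => I n l (G n y)) q
      = hamField (w n (j - 1)) (fun y => I n (l + 1) (G n y)) q := by
  obtain ⟨m, rfl⟩ : ∃ m, j = m + 3 := ⟨j - 3, by omega⟩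
  have h := hamField_I_G_succ (n := n) hl q
  rw [hamField, hamField, w2_eq] at h
  rw [hamField_w, hamField_w, show m + 3 - 2 = m + 1 by omega, show m + 3 - 1 - 2 = m by omega]
  simp only [← Matrix.mulVec_mulVec]
  rw [h, pow_succ]
  simp only [Matrix.mulVec_mulVec, Matrix.mul_assoc]

/-- The integrals are in involution: `d i_l = (Rᵀ)^(l-1) d i_1`, and each `R^m A` is skew. -/
theorem bracket_w_I_G (j : ℕ) {l m : ℕ} (hl : 1 ≤ l) (hm : 1 ≤ m) (q : Fin (2 * n + 2) → ℝ) :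
    bracket (w n j) (fun y => I n l (G n y)) (fun y => I n m (G n y)) q = 0 := by
  obtain ⟨l, rfl⟩ : ∃ l', l = l' + 1 := ⟨l - 1, by omega⟩
  obtain ⟨m, rfl⟩ : ∃ m', m = m' + 1 := ⟨m - 1, by omega⟩
  set R := recA n (G n q) with hR
  set ξ := differential (fun y => I n 1 (G n y)) q
  have hskew : ∀ s : ℕ, ξ ⬝ᵥ ((R ^ s * signMatrix n) *ᵥ ξ) = 0 := by
    intro s
    have h := Matrix.dotProduct_mulVec ξ (R ^ s * signMatrix n) ξ
    rw [← Matrix.mulVec_transpose, recA_pow_mul_transpose, Matrix.neg_mulVec, neg_dotProduct,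
      dotProduct_comm _ ξ] at h
    linarith
  have hRA : ∀ s : ℕ, signMatrix n * Rᵀ ^ s = R ^ s * signMatrix n := fun s =>
    (pow_mul_eq_mul_transpose_pow (recA_mul_signMatrix _) s).symm
  rw [bracket, hamField_w]
  beta_reduce
  rw [differential_I_G_add le_rfl l q, differential_I_G_add le_rfl m q, ← hR,
    ← Matrix.transpose_pow, Matrix.mulVec_transpose, ← Matrix.dotProduct_mulVec]
  simp only [Matrix.mulVec_mulVec]
  rw [mul_assoc (R ^ _) (signMatrix n), hRA, ← mul_assoc, ← mul_assoc, ← pow_add, ← pow_add]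
  exact hskew _

end Hierarchy

end

end KM


theorem mainTheorem4 (n : ℕ) :
    -- `w_2` is invertible, so that the recursion operator makes sense, and it generates `w_3`
    (∀ q, IsUnit (KM.w2 n q).det) ∧ KM.w n 2 = KM.w2 n ∧ KM.w n 3 = KM.w3 n ∧
    -- the `w_j` are Poisson tensors
    (∀ j, 2 ≤ j → KM.IsPoissonOn (KM.w n j) Set.univ) ∧
    -- `X_0` is a conformal symmetry
    (∀ q, KM.lieTensor (KM.X0 n) (KM.w2 n) q = 0) ∧
    (∀ q, KM.lieTensor (KM.X0 n) (KM.w3 n) q = KM.w3 n q) ∧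
    (∀ q, KM.lieFun (KM.X0 n) (KM.i1 n) q = KM.i1 n q) ∧
    -- the `X_k` are smooth and are master symmetries of the flows of the hierarchy
    (∀ k, ContDiff ℝ ∞ (KM.X n k)) ∧
    (∀ k j, 1 ≤ j → KM.IsMasterSymmetry (KM.X n k) (KM.chi n j)) ∧
    -- the deformation relations for the tensors and for the vector fields
    (∀ k j, 2 ≤ j → ∀ q, KM.lieTensor (KM.X n k) (KM.w n j) q
      = ((j : ℝ) - (k : ℝ) - 2) • KM.w n (k + j) q) ∧
    (∀ k j q, VectorField.lieBracket ℝ (KM.X n k) (KM.X n j) q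
      = ((j : ℝ) - (k : ℝ)) • KM.X n (k + j) q) ∧
    -- the Hamiltonians `i_j` of the flows `χ_j`, their deformation relations, their projections
    ∃ i : ℕ → (Fin (2 * n + 2) → ℝ) → ℝ,
      i 1 = KM.i1 n ∧
      (∀ j, 1 ≤ j → ContDiff ℝ ∞ (i j) ∧
        (∀ q, KM.hamField (KM.w2 n) (i j) q = KM.chi n j q) ∧
        (∀ f : (Fin (2 * n + 2) → ℝ) → ℝ, Differentiable ℝ f →
          (∀ q, KM.hamField (KM.w2 n) f q = KM.chi n j q) → ∃ c : ℝ, ∀ q, f q = i j q + c) ∧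
        (∀ k q, KM.lieFun (KM.X n k) (i j) q = ((k : ℝ) + (j : ℝ)) * i (k + j) q) ∧
        (∀ q, i j q = KM.I n j (KM.G n q))) ∧
      (∀ j l, 3 ≤ j → 1 ≤ l → ∀ q,
        KM.hamField (KM.w n j) (i l) q = KM.hamField (KM.w n (j - 1)) (i (l + 1)) q) ∧
    -- the projection by `G`: tensors `v_j`, vector fields `Y_k`, Toda tensors `π_m`
    Set.range (KM.G n) = KM.Va n ∧
    ∃ (v : ℕ → (Fin (2 * n + 1) → ℝ) → Matrix (Fin (2 * n + 1)) (Fin (2 * n + 1)) ℝ)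
      (Y : ℕ → (Fin (2 * n + 1) → ℝ) → Fin (2 * n + 1) → ℝ)
      (π : ℕ → (Fin (2 * n + 1) ⊕ Fin (2 * n + 2) → ℝ) →
        Matrix (Fin (2 * n + 1) ⊕ Fin (2 * n + 2)) (Fin (2 * n + 1) ⊕ Fin (2 * n + 2)) ℝ),
      (∀ j, 2 ≤ j → KM.MapsTensor (KM.G n) (KM.w n j) (v j)) ∧
      (∀ k, KM.MapsField (KM.G n) (KM.X n k) (Y k)) ∧
      -- the `v_j` are the Poisson tensors of the KM hierarchy
      (∀ a ∈ KM.Va n, v 2 a = KM.v2 n a) ∧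
      (∀ a ∈ KM.Va n, v 3 a = KM.v3 n a) ∧
      (∀ m, 1 ≤ m → KM.MapsTensor (KM.flaschka n) (KM.J n m) (π m)) ∧
      (∀ j, 2 ≤ j → KM.IsInvolutionReduction (KM.Tab n) (KM.todaInvolution n) (KM.Va n)
        (KM.todaFixed n) (π (2 * j - 2)) (v j)) ∧
      (∀ j, 2 ≤ j → KM.IsPoissonOn (v j) (KM.Va n)) ∧
      -- the multi-Hamiltonian formulation and the involutivity of the integrals
      (∀ a ∈ KM.Va n, KM.hamField (v 2) (KM.I n 1) a = KM.kmField n a) ∧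
      (∀ j l, 3 ≤ j → 1 ≤ l → ∀ a ∈ KM.Va n,
        KM.hamField (v j) (KM.I n l) a = KM.hamField (v (j - 1)) (KM.I n (l + 1)) a) ∧
      (∀ j l m, 2 ≤ j → 1 ≤ l → 1 ≤ m → ∀ a ∈ KM.Va n,
        KM.bracket (v j) (KM.I n l) (KM.I n m) a = 0) ∧
      -- the deformation relations in the `a`-space
      (∀ k, ContDiffOn ℝ ∞ (Y k) (KM.Va n)) ∧
      (∀ k j, 1 ≤ j → ∀ a ∈ KM.Va n,
        KM.lieFun (Y k) (KM.I n j) a = ((k : ℝ) + (j : ℝ)) * KM.I n (k + j) a) ∧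
      (∀ k j, 2 ≤ j → ∀ a ∈ KM.Va n,
        KM.lieTensor (Y k) (v j) a = ((j : ℝ) - (k : ℝ) - 2) • v (k + j) a) ∧
      (∀ k j, ∀ a ∈ KM.Va n, VectorField.lieBracket ℝ (Y k) (Y j) a
        = ((j : ℝ) - (k : ℝ)) • Y (k + j) a) := by
  have hG := KM.contDiff_G n
  -- identities on `V_a` may be checked at the points `G q`
  have hVa : ∀ {p : (Fin (2 * n + 1) → ℝ) → Prop}, (∀ q, p (KM.G n q)) → ∀ a ∈ KM.Va n, p a := by
    intro p hp a ha
    rw [← KM.range_G] at ha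
    obtain ⟨q, rfl⟩ := ha
    exact hp q
  have hw2 : KM.w n 2 = KM.w2 n := by
    funext q
    simp [KM.w]
  have hw3 : KM.w n 3 = KM.w3 n := by
    funext q
    simp [KM.w_eq, KM.w3_eq]
  have hX0 : KM.X n 0 = KM.X0 n := by
    funext q
    simp [KM.X]
  refine ⟨fun _ => KM.isUnit_signMatrix_det n, hw2, hw3, fun j _ => KM.isPoissonOn_w n j,
    fun q => ?_, fun q => ?_, fun q => ?_, KM.contDiff_X n,
    fun k j hj => KM.isMasterSymmetry_X k hj, fun k j hj => KM.lieTensor_X_w k hj,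
    KM.lieBracket_X, fun j q => KM.I n j (KM.G n q), (KM.i1_eq n).symm,
    fun j hj => ⟨KM.contDiff_I_G n j, fun q => (KM.chi_eq hj q).symm,
      fun f hf h => KM.hamField_unique hj hf h, fun k q => KM.lieFun_X_I_G hj k q, fun q => rfl⟩,
    fun j l hj hl => KM.hamField_w_succ hj hl, KM.range_G n, KM.kmTensor n, KM.kmMaster n,
    KM.todaPi n, fun j _ => KM.mapsTensor_kmTensor n j, KM.mapsField_kmMaster n,
    fun a _ => KM.kmTensor_two a, fun a _ => KM.kmTensor_three a,
    fun m _ => KM.mapsTensor_todaPi n m, fun j hj => KM.isInvolutionReduction_kmTensor hj,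
    fun j _ => KM.isPoissonOn_kmTensor n j, fun a _ => ?_, fun j l hj hl => hVa fun q => ?_,
    fun j l m _ hl hm => hVa fun q => ?_, fun k => (KM.contDiff_kmMaster n k).contDiffOn,
    fun k j hj => hVa fun q => ?_, fun k j hj => hVa fun q => ?_, fun k j => hVa fun q => ?_⟩
  · rw [← hX0, ← hw2, KM.lieTensor_X_w 0 le_rfl]
    simp
  · rw [← hX0, ← hw3, KM.lieTensor_X_w 0 (by norm_num)]
    norm_num
  · rw [KM.i1_eq, KM.lieFun_X0_I_G le_rfl]
    simp
  · rw [funext KM.kmTensor_two]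
    exact KM.kmField_eq a
  · rw [(KM.mapsTensor_kmTensor n j).hamField hG (KM.contDiff_I n l) q,
      (KM.mapsTensor_kmTensor n (j - 1)).hamField hG (KM.contDiff_I n (l + 1)) q,
      KM.hamField_w_succ hj hl]
  · rw [(KM.mapsTensor_kmTensor n j).bracket hG (KM.contDiff_I n l) (KM.contDiff_I n m),
      KM.bracket_w_I_G j hl hm]
  · rw [(KM.mapsField_kmMaster n k).lieFun hG (KM.contDiff_I n j), KM.lieFun_X_I_G hj]
  · rw [KM.MapsTensor.lieTensor hG (KM.contDiff_X n k) (KM.contDiff_kmMaster n k)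
      (KM.smoothMatrix_w n j) (KM.smoothMatrix_kmTensor n j) (KM.mapsField_kmMaster n k)
      (KM.mapsTensor_kmTensor n j) q, KM.lieTensor_X_w k hj, KM.mapsTensor_kmTensor n (k + j) q,
      Matrix.mul_smul, Matrix.smul_mul]
  · rw [KM.MapsField.lieBracket hG (KM.contDiff_X n k) (KM.contDiff_kmMaster n k)
      (KM.contDiff_X n j) (KM.contDiff_kmMaster n j) (KM.mapsField_kmMaster n k)
      (KM.mapsField_kmMaster n j) q, KM.lieBracket_X, KM.mapsField_kmMaster n (k + j) q,
      Matrix.mulVec_smul]
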